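/- **Theorem 2.1.** Let $d\ge 2$ and $k\ge 1$ be integers and let $Q^d:=[0,1)^d$. A *cube* is a set $\prod_{i=1}^d[a_i,a_i+h)$ with $a\in\mathbb R^d$, $h>0$; a *dyadic cube* is a cube $2^{-j}(Q^d+\alpha)$ with $j\in\mathbb Z_+$, $\alpha\in\mathbb Z^d$, contained in $Q^d$; a *dyadic $d$-ring* is either a dyadic cube $Q'$ or a difference $Q'\setminus Q''$ of two dyadic cubes $Q''\subsetneq Q'$. For $1\le p<q\le\infty$ and a function $f:Q^d\to\mathbb R$ put $$E_k(f;Q;L_q):=\inf_m\|f-m\|_{L_q(Q)},\qquad |f|_{V_{pq}^k}:=\sup_\Delta\Big\{\sum_{Q\in\Delta}E_k(f;Q;L_q)^p\Big\}^{1/p},$$ where $m$ runs over the polynomials in $d$ variables of total degree at most $k-1$, and $\Delta$ runs over all families of pairwise disjoint cubes $Q\subset Q^d$. Let $V_{pq}^k=V_{pq}^k(Q^d)$ be the space of $f\in L_q(Q^d)$ with $|f|_{V_{pq}^k}<\infty$, and let $s:=d\left(\frac1p-\frac1q\right)$ be its smoothness (with $\frac1\infty:=0$). For a finite family $\Delta$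 of subsets of $Q^d$, a *piecewise polynomial of degree $k-1$ over $\Delta$* is a function $\sum_{K\in\Delta}P_K\cdot 1_K$ with polynomials $P_K$ of total degree at most $k-1$. There is a constant $c=c(k,d)>0$, depending only on $k$ and $d$, such that the following holds for all $1\le p<q\le\infty$ with $0<s\le k$, all $f\in V_{pq}^k(Q^d)$, which in the case $q=\infty$ are in addition assumed to be uniformly continuous on $Q^d$, and all integers $N\ge1$. (a) There exist a covering $\Delta_N$ of $Q^d$ by at most $N$ dyadic cubes and a piecewise polynomial $g_N$ of degree $k-1$ over $\Delta_N$ such that $$\|f-g_N\|_{L_q(Q^d)}\le c\,N^{-s/d}\,|f|_{V_{pq}^k}.$$ (b) There exist a partition $\Delta_N$ of $Q^d$ into at most $N$ dyadic $d$-rings and a piecewise polynomial $g_N$ of degree $k-1$ over $\Delta_N$ satisfying the same inequality. -/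

import Mathlib

open MeasureTheory
open scoped ENNReal

noncomputable section

namespace PiecewiseApprox

/-- The half-open cube `∏ᵢ [aᵢ, aᵢ + h)` in `ℝ^d`. -/
def box {d : ℕ} (a : Fin d → ℝ) (h : ℝ) : Set (Fin d → ℝ) :=
  {x | ∀ i, a i ≤ x i ∧ x i < a i + h}

/-- A cube: a set homothetic to `[0,1)^d`. -/
def IsCube {d : ℕ} (Q : Set (Fin d → ℝ)) : Prop :=
  ∃ (a : Fin d → ℝ) (h : ℝ), 0 < h ∧ Q = box a h

/-- The unit cube `[0,1)^d`. -/
def unitCube (d : ℕ) : Set (Fin d → ℝ) :=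
  box 0 1

/-- Dyadic subcubes of `[0,1)^d`: the cubes `2^{-j}([0,1)^d + α)`, with `j ≥ 0` and `α ∈ ℤ^d`,
that are contained in `[0,1)^d`. -/
def IsDyadicCube {d : ℕ} (K : Set (Fin d → ℝ)) : Prop :=
  K ⊆ unitCube d ∧
    ∃ (j : ℕ) (α : Fin d → ℤ), K = box (fun i => (α i : ℝ) / 2 ^ j) (1 / 2 ^ j)

/-- Dyadic `d`-rings: the dyadic cubes `Q'` themselves, and the differences `Q' \ Q''` of two dyadic
cubes `Q'' ⊊ Q'`. -/
def IsDyadicRing {d : ℕ} (R : Set (Fin d → ℝ)) : Prop :=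
  IsDyadicCube R ∨
    ∃ Q' Q'' : Set (Fin d → ℝ), IsDyadicCube Q' ∧ IsDyadicCube Q'' ∧ Q'' ⊂ Q' ∧ R = Q' \ Q''

/-- The best approximation `E_k(f; S; L_q)` of `f` in `L_q(S)` by polynomials in `d` variables
of (total) degree at most `k - 1`, where `k ≥ 1`. -/
def bestApprox {d : ℕ} (k : ℕ) (f : (Fin d → ℝ) → ℝ) (S : Set (Fin d → ℝ)) (q : ℝ≥0∞) : ℝ≥0∞ :=
  ⨅ m ∈ {m : MvPolynomial (Fin d) ℝ | m.totalDegree ≤ k - 1},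
    eLpNorm (fun x => f x - MvPolynomial.eval x m) q (volume.restrict S)

/-- The `(k,p)`-variation `var_p^k(f; S; L_q)`: the supremum of `(∑_{Q ∈ Δ} E_k(f; Q; L_q)^p)^{1/p}`
over all families `Δ` of pairwise disjoint cubes contained in `S`. -/
def variation {d : ℕ} (k : ℕ) (p : ℝ) (q : ℝ≥0∞) (f : (Fin d → ℝ) → ℝ)
    (S : Set (Fin d → ℝ)) : ℝ≥0∞ :=
  ⨆ Δ ∈ {Δ : Set (Set (Fin d → ℝ)) | (∀ Q ∈ Δ, IsCube Q ∧ Q ⊆ S) ∧ Δ.PairwiseDisjoint id},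
    (∑' Q : Δ, bestApprox k f (Q : Set (Fin d → ℝ)) q ^ p) ^ (1 / p)

/-- The seminorm `|f|_{V_{pq}^k}` on the unit cube. -/
def seminormV {d : ℕ} (k : ℕ) (p : ℝ) (q : ℝ≥0∞) (f : (Fin d → ℝ) → ℝ) : ℝ≥0∞ :=
  variation k p q f (unitCube d)

/-- Membership in `V_{pq}^k([0,1)^d)`. -/
def MemV {d : ℕ} (k : ℕ) (p : ℝ) (q : ℝ≥0∞) (f : (Fin d → ℝ) → ℝ) : Prop :=
  MemLp f q (volume.restrict (unitCube d)) ∧ seminormV k p q f < ∞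

/-- The smoothness `s(V_{pq}^k) = d (1/p - 1/q)`, with `1/∞ = 0`. -/
def smoothness (d : ℕ) (p : ℝ) (q : ℝ≥0∞) : ℝ :=
  d * (1 / p - (q⁻¹).toReal)

/-- Piecewise polynomials `∑_{K ∈ Δ} P_K · 1_K` of degree `l` over a finite family `Δ` of sets. -/
def IsPiecewisePoly {d : ℕ} (l : ℕ) (Δ : Finset (Set (Fin d → ℝ))) (g : (Fin d → ℝ) → ℝ) : Prop :=
  ∃ P : Set (Fin d → ℝ) → MvPolynomial (Fin d) ℝ,
    (∀ K ∈ Δ, (P K).totalDegree ≤ l) ∧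
      ∀ x, g x = ∑ K ∈ Δ, K.indicator (fun y => MvPolynomial.eval y (P K)) x

/-- A finite covering of the unit cube by dyadic cubes. -/
def IsDyadicCovering {d : ℕ} (Δ : Finset (Set (Fin d → ℝ))) : Prop :=
  (∀ K ∈ Δ, IsDyadicCube K) ∧ (⋃ K ∈ Δ, K) = unitCube d

/-- A finite partition of the unit cube into dyadic `d`-rings. -/
def IsRingPartition {d : ℕ} (Δ : Finset (Set (Fin d → ℝ))) : Prop :=
  (∀ R ∈ Δ, IsDyadicRing R) ∧ (Δ : Set (Set (Fin d → ℝ))).PairwiseDisjoint id ∧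
    (⋃ R ∈ Δ, R) = unitCube d

end PiecewiseApprox

end

noncomputable section

namespace PiecewiseApprox

variable {d : ℕ}

/-! ### Cubes and `L_q` norms over finite unions -/

/-! Let ψ(S) be the supremum of ∑ E_k(f;Q)^p over finite disjoint families of cubes in S. This
charge is superadditive, and ψ of the unit cube is at most V^p, where V is the seminorm of f. The
proof cuts the unit cube into at most N dyadic rings R with ψ(R) ≤ t, where t is of order V^p/N.
Every cube inside such a ring then has E_k ≤ t^{1/p}. If this forces a single polynomial to
approximate f on the whole ring with error C t^{1/p}, then the L_q norm over N rings is at most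
N^{1/q} C t^{1/p}, of order N^{1/q-1/p} V, which is the claim.

From cubes to rings (`exists_approxOn_ring`): a polynomial that is good on one cube remains good on
a cube shifted by at most half a side, since two polynomials close on the overlap are close on the
whole cube. Chains of such shifts carry it through boxes of bounded eccentricity. For d ≥ 2 a ring
is covered by 2d such boxes, linked by common corner cubes. The grid structure keeps a gap between
the inner cube and a face of the outer one from being positive but smaller than the inner cube.

Counting the rings (`decomposes_dyadic`): descend the dyadic tree along cubes of charge above t. As
long as one heavy child carries all but t of the charge, nothing is cut and the ring around it
grows. Every actual cut is paid for by superadditivity.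

The descent need not terminate, so it stops at a level J. The heavy cubes of that level are handled
by a function constant on level-J cubes whose distance from f in L_q is at most N^{1/q-1/p} V. This
is where uniform continuity enters for q = ∞.

For coverings, P·1_{Q' \ Q''} = P·1_{Q'} - P·1_{Q''}, so ⌊N/2⌋ rings yield at most N cubes. -/

lemma box_eq_pi (a : Fin d → ℝ) (h : ℝ) :
    box a h = Set.pi Set.univ fun i => Set.Ico (a i) (a i + h) := by
  ext x; simp [box, Set.mem_pi]

lemma measurableSet_box (a : Fin d → ℝ) (h : ℝ) : MeasurableSet (box a h) := by
  rw [box_eq_pi]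
  exact MeasurableSet.univ_pi fun i => measurableSet_Ico

lemma volume_unitCube : volume (unitCube d) = 1 := by
  rw [unitCube, box_eq_pi, Real.volume_pi_Ico]
  simp

lemma isProbabilityMeasure_unitCube :
    IsProbabilityMeasure (volume.restrict (unitCube d)) :=
  ⟨by simp [volume_unitCube]⟩

lemma volume_box_lt_top (a : Fin d → ℝ) (h : ℝ) : volume (box a h) < ∞ := by
  rw [box_eq_pi, Real.volume_pi_Ico]
  exact ENNReal.prod_lt_top fun i _ => ENNReal.ofReal_lt_top

lemma restrict_biUnion_finset_le {α ι : Type*} [MeasurableSpace α] (μ : Measure α)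
    (s : Finset ι) (S : ι → Set α) :
    μ.restrict (⋃ i ∈ s, S i) ≤ ∑ i ∈ s, μ.restrict (S i) := by
  classical
  induction s using Finset.induction_on with
  | empty => simp
  | insert i s hi ih =>
    rw [Finset.set_biUnion_insert, Finset.sum_insert hi]
    exact (Measure.restrict_union_le _ _).trans (add_le_add le_rfl ih)

/-- If the `L_q` norm of `F` over each of `n` sets is at most `e`, then it is at most `n^{1/q} e`
over their union. -/
lemma eLpNorm_biUnion_le {α ι : Type*} [MeasurableSpace α] {μ : Measure α} {F : α → ℝ}
    {q : ℝ≥0∞} (hq : q ≠ 0) (s : Finset ι) (S : ι → Set α) {e : ℝ≥0∞}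
    (h : ∀ i ∈ s, eLpNorm F q (μ.restrict (S i)) ≤ e) :
    eLpNorm F q (μ.restrict (⋃ i ∈ s, S i)) ≤ (s.card : ℝ≥0∞) ^ (q⁻¹).toReal * e := by
  refine (eLpNorm_mono_measure F (restrict_biUnion_finset_le μ s S)).trans ?_
  rcases eq_or_ne q ∞ with rfl | hq'
  · simp only [ENNReal.inv_top, ENNReal.toReal_zero, ENNReal.rpow_zero, one_mul]
    simp only [eLpNorm_exponent_top] at h ⊢
    refine essSup_le_of_ae_le _ ?_
    have : ∀ i ∈ s, ∀ᵐ x ∂(μ.restrict (S i)), ‖F x‖ₑ ≤ e := fun i hi =>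
      (ae_le_eLpNormEssSup (f := F)).mono fun x hx => hx.trans (h i hi)
    rw [← Measure.sum_coe_finset]
    refine Measure.ae_sum_iff.mpr fun i => this i i.2
  · have hpos := ENNReal.toReal_pos hq hq'
    rw [eLpNorm_eq_lintegral_rpow_enorm_toReal hq hq', lintegral_finsetSum_measure]
    have : ∀ i ∈ s, ∫⁻ x, ‖F x‖ₑ ^ q.toReal ∂(μ.restrict (S i)) ≤ e ^ q.toReal := by
      intro i hi
      have := h i hi
      rw [eLpNorm_eq_lintegral_rpow_enorm_toReal hq hq'] at this
      rwa [one_div, ENNReal.rpow_inv_le_iff hpos] at this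
    rw [one_div, ENNReal.rpow_inv_le_iff hpos, ENNReal.mul_rpow_of_nonneg _ _ hpos.le,
      ← ENNReal.rpow_mul, ENNReal.toReal_inv, inv_mul_cancel₀ hpos.ne', ENNReal.rpow_one]
    exact (Finset.sum_le_card_nsmul _ _ _ this).trans (by simp)

lemma eLpNorm_biUnion_le_card_mul {α ι : Type*} [MeasurableSpace α] {μ : Measure α} {F : α → ℝ}
    {q : ℝ≥0∞} (hq : 1 ≤ q) (s : Finset ι) (S : ι → Set α) {e : ℝ≥0∞}
    (h : ∀ i ∈ s, eLpNorm F q (μ.restrict (S i)) ≤ e) :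
    eLpNorm F q (μ.restrict (⋃ i ∈ s, S i)) ≤ (s.card : ℝ≥0∞) * e := by
  rcases s.eq_empty_or_nonempty with rfl | hs
  · simp
  refine (eLpNorm_biUnion_le (zero_lt_one.trans_le hq).ne' s S h).trans ?_
  gcongr
  have h1 : (1 : ℝ≥0∞) ≤ s.card := by exact_mod_cast hs.card_pos
  calc (s.card : ℝ≥0∞) ^ (q⁻¹).toReal ≤ (s.card : ℝ≥0∞) ^ (1 : ℝ) :=
        ENNReal.rpow_le_rpow_of_exponent_le h1
          (ENNReal.toReal_le_of_le_ofReal zero_le_one (by simpa using hq))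
    _ = _ := ENNReal.rpow_one _

/-! ### Polynomials of bounded degree -/

lemma continuous_eval (m : MvPolynomial (Fin d) ℝ) :
    Continuous fun x : Fin d → ℝ => MvPolynomial.eval x m :=
  MvPolynomial.continuous_eval m

lemma totalDegree_bind₁_le_of_le_one {m : MvPolynomial (Fin d) ℝ}
    {φ : Fin d → MvPolynomial (Fin d) ℝ} (hφ : ∀ i, (φ i).totalDegree ≤ 1) :
    (MvPolynomial.bind₁ φ m).totalDegree ≤ m.totalDegree := by
  conv_lhs => rw [m.as_sum, map_sum]
  refine MvPolynomial.totalDegree_finsetSum_le fun s hs => ?_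
  rw [MvPolynomial.bind₁_monomial]
  refine (MvPolynomial.totalDegree_mul _ _).trans ?_
  rw [MvPolynomial.totalDegree_C, zero_add]
  refine (MvPolynomial.totalDegree_finsetProd _ _).trans ?_
  refine le_trans ?_ (MvPolynomial.le_totalDegree hs)
  refine Finset.sum_le_sum fun i _ => ?_
  exact (MvPolynomial.totalDegree_pow _ _).trans (by simpa using Nat.mul_le_mul_left _ (hφ i))

/-- Affine substitutions do not increase the degree. -/
lemma exists_poly_comp_affine (m : MvPolynomial (Fin d) ℝ) (a : Fin d → ℝ) (h : ℝ) :
    ∃ u : MvPolynomial (Fin d) ℝ, u.totalDegree ≤ m.totalDegree ∧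
      ∀ y, MvPolynomial.eval y u = MvPolynomial.eval (a + h • y) m := by
  refine ⟨MvPolynomial.bind₁ (fun i => MvPolynomial.C (a i) + MvPolynomial.C h * MvPolynomial.X i)
    m, totalDegree_bind₁_le_of_le_one fun i => ?_, fun y => ?_⟩
  · refine (MvPolynomial.totalDegree_add _ _).trans (max_le (by simp) ?_)
    refine (MvPolynomial.totalDegree_mul _ _).trans (by simp)
  · rw [MvPolynomial.eval, MvPolynomial.eval₂Hom_bind₁]
    simp only [MvPolynomial.coe_eval₂Hom]
    congr 1
    ext i
    simp

lemma memLp_eval (m : MvPolynomial (Fin d) ℝ) (a : Fin d → ℝ) (h : ℝ) (q : ℝ≥0∞) :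
    MemLp (fun x => MvPolynomial.eval x m) q (volume.restrict (box a h)) := by
  have : IsFiniteMeasure (volume.restrict (box a h)) := ⟨by simpa using volume_box_lt_top a h⟩
  have hc : IsCompact (Set.Icc a (fun i => a i + h)) := isCompact_Icc
  obtain ⟨C, hC⟩ := hc.exists_bound_of_continuousOn (continuous_eval m).continuousOn
  refine MemLp.of_bound (continuous_eval m).aestronglyMeasurable C ?_
  refine (ae_restrict_mem (measurableSet_box a h)).mono fun x hx => hC x ?_
  exact ⟨fun i => (hx i).1, fun i => (hx i).2.le⟩

lemma eq_zero_of_ae_unitCube {m : MvPolynomial (Fin d) ℝ}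
    (h : (fun x => MvPolynomial.eval x m) =ᵐ[volume.restrict (unitCube d)] 0) : m = 0 := by
  set U : Set (Fin d → ℝ) := Set.pi Set.univ fun _ => Set.Ioo (0 : ℝ) 1
  have hU : IsOpen U := isOpen_set_pi Set.finite_univ fun _ _ => isOpen_Ioo
  have hsub : U ⊆ unitCube d := fun x hx i =>
    ⟨(hx i trivial).1.le, by simpa using (hx i trivial).2⟩
  have h0 := Measure.eqOn_open_of_ae_eq (ae_restrict_of_ae_restrict_of_subset hsub h) hU
    (continuous_eval m).continuousOn continuousOn_const
  refine MvPolynomial.funext_set (fun _ => Set.Ioo (0 : ℝ) 1)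
    (fun _ => Set.Ioo_infinite zero_lt_one) fun x hx => ?_
  simpa using h0 hx

/-- The inclusion of polynomials of degree at most `l` into `L_q` of a cube. -/
def polyToLp (l : ℕ) (a : Fin d → ℝ) (h : ℝ) (q : ℝ≥0∞) :
    MvPolynomial.restrictTotalDegree (Fin d) ℝ l →ₗ[ℝ] Lp ℝ q (volume.restrict (box a h)) where
  toFun m := (memLp_eval m.1 a h q).toLp _
  map_add' m n := by
    rw [← MemLp.toLp_add]
    exact MemLp.toLp_congr _ _ (Filter.Eventually.of_forall fun x => by simp)
  map_smul' c m := by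
    rw [RingHom.id_apply, ← MemLp.toLp_const_smul]
    exact MemLp.toLp_congr _ _ (Filter.Eventually.of_forall fun x => by simp)

lemma polyToLp_ae_eq (l : ℕ) (a : Fin d → ℝ) (h : ℝ) (q : ℝ≥0∞)
    (m : MvPolynomial.restrictTotalDegree (Fin d) ℝ l) :
    polyToLp l a h q m =ᵐ[volume.restrict (box a h)] fun x => MvPolynomial.eval x m.1 :=
  (memLp_eval m.1 a h q).coeFn_toLp

/-- Polynomials of degree at most `l` on a bounded set are controlled by their `L_1` norms over the
unit cube. -/
lemma exists_abs_eval_le (d l : ℕ) (M : ℝ) : ∃ C : ℝ, 0 ≤ C ∧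
    ∀ m : MvPolynomial (Fin d) ℝ, m.totalDegree ≤ l → ∀ y : Fin d → ℝ, (∀ i, |y i| ≤ M) →
      ‖MvPolynomial.eval y m‖ₑ ≤ ENNReal.ofReal C *
        eLpNorm (fun x => MvPolynomial.eval x m) 1 (volume.restrict (unitCube d)) := by
  set V := MvPolynomial.restrictTotalDegree (Fin d) ℝ l
  let b := Module.finBasis ℝ V
  let n := Module.finrank ℝ V
  let T : (Fin n → ℝ) →ₗ[ℝ] Lp ℝ 1 (volume.restrict (box (0 : Fin d → ℝ) 1)) :=
    (polyToLp l 0 1 1).comp b.equivFun.symm.toLinearMap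
  -- An injective linear map from a finite-dimensional space is antilipschitz, so the L_1 norm
  -- controls the coefficients, and these control the values on a bounded set.
  have hT : LinearMap.ker T = ⊥ := by
    rw [LinearMap.ker_eq_bot']
    intro v hv
    have h1 : polyToLp l (0 : Fin d → ℝ) 1 1 (b.equivFun.symm v) = 0 := hv
    have h2 := polyToLp_ae_eq l (0 : Fin d → ℝ) 1 1 (b.equivFun.symm v)
    rw [h1] at h2
    have h3 : (b.equivFun.symm v).1 = 0 :=
      eq_zero_of_ae_unitCube (h2.symm.trans (Lp.coeFn_zero _ _ _))
    have h4 : b.equivFun.symm v = 0 := Subtype.ext h3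
    exact (LinearEquiv.map_eq_zero_iff _).mp h4
  obtain ⟨K, -, hK⟩ := T.exists_antilipschitzWith hT
  have hc : IsCompact (Set.pi Set.univ fun _ : Fin d => Set.Icc (-M) M) :=
    isCompact_univ_pi fun _ => isCompact_Icc
  have hB : ∀ j : Fin n, ∃ B : ℝ, 0 ≤ B ∧
      ∀ y ∈ (Set.pi Set.univ fun _ : Fin d => Set.Icc (-M) M),
      |MvPolynomial.eval y (b j).1| ≤ B := fun j => by
    obtain ⟨C, hC⟩ := hc.exists_bound_of_continuousOn (continuous_eval (b j).1).continuousOn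
    exact ⟨max C 0, le_max_right _ _, fun y hy => (hC y hy).trans (le_max_left _ _)⟩
  choose B hB0 hB using hB
  have hB1 : 0 ≤ ∑ j, B j := Finset.sum_nonneg fun j _ => hB0 j
  refine ⟨(∑ j, B j) * K, by positivity, fun m hm y hy => ?_⟩
  let m' : V := ⟨m, (MvPolynomial.mem_restrictTotalDegree _ _ _).mpr hm⟩
  set v := b.equivFun m' with hv
  have hTv : T v = polyToLp l 0 1 1 m' := by
    change polyToLp l 0 1 1 (b.equivFun.symm v) = _
    rw [hv, LinearEquiv.symm_apply_apply]
  have hm' : m = ∑ j, v j • (b j).1 := by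
    have := b.sum_equivFun m'
    have h2 := congrArg Subtype.val this
    rw [← hv] at h2
    rw [Submodule.coe_sum] at h2
    exact h2.symm
  have h1 : |MvPolynomial.eval y m| ≤ (∑ j, B j) * ‖v‖ := by
    rw [hm', map_sum, Finset.sum_mul]
    refine (Finset.abs_sum_le_sum_abs _ _).trans (Finset.sum_le_sum fun j _ => ?_)
    rw [MvPolynomial.smul_eval, abs_mul, mul_comm]
    exact mul_le_mul (hB j y fun i _ => abs_le.mp (hy i)) (norm_le_pi_norm v j) (abs_nonneg _)
      (hB0 j)
  have h2 : ‖v‖ ≤ K * ‖T v‖ := by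
    have := hK.le_mul_dist v 0
    simpa using this
  have h3 : ENNReal.ofReal ‖T v‖ =
      eLpNorm (fun x => MvPolynomial.eval x m) 1 (volume.restrict (unitCube d)) := by
    rw [ofReal_norm, hTv, Lp.enorm_def]
    exact eLpNorm_congr_ae (polyToLp_ae_eq l _ _ _ m')
  rw [← h3, ← ENNReal.ofReal_mul (by positivity), ← ofReal_norm]
  refine ENNReal.ofReal_le_ofReal (h1.trans ?_)
  rw [mul_assoc]
  exact mul_le_mul_of_nonneg_left h2 hB1

/-- Near-best approximation, exact when the error vanishes. -/
lemma exists_poly_eLpNorm_le {k : ℕ} {f : (Fin d → ℝ) → ℝ} {q : ℝ≥0∞} (hq : 1 ≤ q)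
    {a : Fin d → ℝ} {h : ℝ} (hf : MemLp f q (volume.restrict (box a h))) :
    ∃ m : MvPolynomial (Fin d) ℝ, m.totalDegree ≤ k - 1 ∧
      eLpNorm (fun x => f x - MvPolynomial.eval x m) q (volume.restrict (box a h)) ≤
        2 * bestApprox k f (box a h) q := by
  rcases eq_or_ne (bestApprox k f (box a h) q) 0 with h0 | h0
  · have : Fact (1 ≤ q) := ⟨hq⟩
    -- When the infimum is 0 the factor 2 gives no room, so a minimiser must exist. It does, because
    -- a finite-dimensional subspace is closed.
    have hcl : IsClosed (LinearMap.range (polyToLp (k - 1) a h q) :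
        Set (Lp ℝ q (volume.restrict (box a h)))) :=
      Submodule.closed_of_finiteDimensional _
    have hmem : hf.toLp f ∈ closure (LinearMap.range (polyToLp (k - 1) a h q) :
        Set (Lp ℝ q (volume.restrict (box a h)))) := by
      rw [EMetric.mem_closure_iff]
      intro ε hε
      rw [← h0, bestApprox] at hε
      obtain ⟨m, hm⟩ := iInf_lt_iff.mp hε
      obtain ⟨hm1, hm2⟩ := iInf_lt_iff.mp hm
      refine ⟨_, ⟨⟨m, (MvPolynomial.mem_restrictTotalDegree _ _ _).mpr hm1⟩, rfl⟩, ?_⟩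
      rw [polyToLp]
      simp only [LinearMap.coe_mk, AddHom.coe_mk]
      rw [Lp.edist_toLp_toLp]
      exact hm2
    rw [hcl.closure_eq] at hmem
    obtain ⟨m, hm⟩ := hmem
    refine ⟨m.1, (MvPolynomial.mem_restrictTotalDegree _ _ _).mp m.2, ?_⟩
    have h1 : f =ᵐ[volume.restrict (box a h)] fun x => MvPolynomial.eval x m.1 :=
      hf.coeFn_toLp.symm.trans (hm ▸ polyToLp_ae_eq _ _ _ _ m)
    rw [eLpNorm_congr_ae (g := fun _ => (0 : ℝ)) (h1.mono fun x hx => by simp [hx])]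
    simp
  · rcases eq_or_ne (bestApprox k f (box a h) q) ∞ with ht | ht
    · exact ⟨0, by simp, by simp [ht]⟩
    · have hlt : bestApprox k f (box a h) q < 2 * bestApprox k f (box a h) q := by
        rw [two_mul]; exact ENNReal.lt_add_right ht h0
      conv_lhs at hlt => rw [bestApprox]
      obtain ⟨m, hm⟩ := iInf_lt_iff.mp hlt
      obtain ⟨hm1, hm2⟩ := iInf_lt_iff.mp hm
      exact ⟨m, hm1, hm2.le⟩

/-! ### Comparison of polynomial norms over comparable sets -/

/-- The scaling factor is the same for all sets `A`, so it cancels when norms over two sets are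
compared; its value is never needed. -/
lemma eLpNorm_comp_affine {q : ℝ≥0∞} (F : (Fin d → ℝ) → ℝ) (a : Fin d → ℝ) {h : ℝ} (hh : 0 < h) :
    ∃ c : ℝ≥0∞, c ≠ 0 ∧ c ≠ ∞ ∧ ∀ A : Set (Fin d → ℝ), MeasurableSet A →
      eLpNorm (fun y => F (a + h • y)) q (volume.restrict ((fun y => a + h • y) ⁻¹' A)) =
        c * eLpNorm F q (volume.restrict A) := by
  set T : (Fin d → ℝ) → (Fin d → ℝ) := fun y => a + h • y with hT
  have hemb : MeasurableEmbedding T :=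
    ((Homeomorph.smulOfNeZero h hh.ne').trans (Homeomorph.addLeft a)).measurableEmbedding
  set c : ℝ≥0∞ := ENNReal.ofReal |(h ^ Module.finrank ℝ (Fin d → ℝ))⁻¹| with hc
  have hc0 : c ≠ 0 := by
    have := pow_pos (abs_pos.mpr hh.ne') d
    simpa [hc] using this
  have hct : c ≠ ∞ := ENNReal.ofReal_ne_top
  have hmap : Measure.map T volume = c • volume := by
    have h1 : T = (fun x => a + x) ∘ (fun y => h • y) := rfl
    rw [h1, ← Measure.map_map (measurable_const_add a) (measurable_const_smul h),
      Measure.map_addHaar_smul _ hh.ne', Measure.map_smul,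
      (measurePreserving_add_left volume a).map_eq]
  refine ⟨c ^ (1 / q).toReal, ?_, ?_, fun A hA => ?_⟩
  · simp [ENNReal.rpow_eq_zero_iff, hc0, hct]
  · exact ENNReal.rpow_ne_top_of_nonneg ENNReal.toReal_nonneg hct
  · have h2 := hemb.eLpNorm_map_measure (g := F) (p := q) (μ := volume.restrict (T ⁻¹' A))
    rw [← hemb.restrict_map, hmap, Measure.restrict_smul,
      eLpNorm_smul_measure_of_ne_zero hc0] at h2
    rw [← smul_eq_mul, h2]
    rfl

/-- A polynomial of degree at most `l` on a set close to a cube is controlled by its norm over that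
cube, uniformly in `q`. -/
lemma exists_eLpNorm_eval_le (d l : ℕ) : ∃ C : ℝ≥0∞, C ≠ ∞ ∧
    ∀ (q : ℝ≥0∞), 1 ≤ q → ∀ m : MvPolynomial (Fin d) ℝ, m.totalDegree ≤ l →
      ∀ (b : Fin d → ℝ) (g : ℝ), 0 < g → ∀ A : Set (Fin d → ℝ), MeasurableSet A →
        (∀ x ∈ A, ∀ i, |x i - b i| ≤ 2 * g) →
        eLpNorm (fun x => MvPolynomial.eval x m) q (volume.restrict A) ≤
          C * eLpNorm (fun x => MvPolynomial.eval x m) q (volume.restrict (box b g)) := by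
  obtain ⟨C, -, hC⟩ := exists_abs_eval_le d l 2
  -- After rescaling, `A` lies in a cube of side 4. Its volume enters with exponent 1/q ≤ 1, so 4^d
  -- serves every q. The L_1 norm over the unit cube is at most the L_q norm there.
  refine ⟨4 ^ d * ENNReal.ofReal C, by finiteness, ?_⟩
  intro q hq m hm b g hg A hA hAb
  obtain ⟨c, hc0, hct, hc⟩ := eLpNorm_comp_affine (q := q) (fun x => MvPolynomial.eval x m) b hg
  obtain ⟨u, hu1, hu2⟩ := exists_poly_comp_affine m b g
  rw [← ENNReal.mul_le_mul_iff_right hc0 hct, mul_left_comm, ← hc A hA,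
    ← hc _ (measurableSet_box b g)]
  simp only [← hu2]
  set T : (Fin d → ℝ) → (Fin d → ℝ) := fun y => b + g • y
  have hbox : T ⁻¹' (box b g) = unitCube d := by
    ext y
    refine forall_congr' fun i => ?_
    simp only [T, Pi.add_apply, Pi.smul_apply, smul_eq_mul, Pi.zero_apply, zero_add]
    constructor
    · rintro ⟨h1, h2⟩
      exact ⟨by nlinarith, by nlinarith⟩
    · rintro ⟨h1, h2⟩
      exact ⟨by nlinarith, by nlinarith⟩
  have hsub : ∀ y ∈ T ⁻¹' A, ∀ i, |y i| ≤ 2 := by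
    intro y hy i
    have := hAb _ hy i
    simp only [T, Pi.add_apply, Pi.smul_apply, smul_eq_mul, add_sub_cancel_left, abs_mul,
      abs_of_pos hg] at this
    nlinarith
  have hTA : MeasurableSet (T ⁻¹' A) :=
    (by fun_prop : Measurable T) hA
  rw [hbox]
  have := isProbabilityMeasure_unitCube (d := d)
  set E := eLpNorm (fun x => MvPolynomial.eval x u) q (volume.restrict (unitCube d))
  have h1 : eLpNorm (fun x => MvPolynomial.eval x u) 1 (volume.restrict (unitCube d)) ≤ E :=
    eLpNorm_le_eLpNorm_of_exponent_le hq (continuous_eval u).aestronglyMeasurable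
  have hvol : volume (T ⁻¹' A) ≤ 4 ^ d := by
    have : T ⁻¹' A ⊆ Set.Icc (fun _ => (-2 : ℝ)) (fun _ => 2) := fun y hy =>
      ⟨fun i => (abs_le.mp (hsub y hy i)).1, fun i => (abs_le.mp (hsub y hy i)).2⟩
    refine (measure_mono this).trans ?_
    rw [Real.volume_Icc_pi]
    norm_num
  have h2 : ∀ᵐ y ∂(volume.restrict (T ⁻¹' A)), ‖MvPolynomial.eval y u‖ₑ ≤ ENNReal.ofReal C * E := by
    refine (ae_restrict_mem hTA).mono fun y hy => ?_
    refine (hC u (hu1.trans hm) y (hsub y hy)).trans ?_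
    gcongr
  refine (eLpNorm_le_of_ae_enorm_bound h2).trans ?_
  rw [smul_eq_mul, mul_comm, mul_assoc (4 ^ d)]
  gcongr
  rw [Measure.restrict_apply_univ]
  have h4 : (1 : ℝ≥0∞) ≤ 4 ^ d := one_le_pow₀ (by norm_num)
  calc volume (T ⁻¹' A) ^ q.toReal⁻¹ ≤ (4 ^ d) ^ q.toReal⁻¹ := by gcongr
    _ ≤ (4 ^ d) ^ (1 : ℝ) := by
        refine ENNReal.rpow_le_rpow_of_exponent_le h4 ?_
        rw [← ENNReal.toReal_inv]
        exact ENNReal.toReal_le_of_le_ofReal zero_le_one (by simpa using hq)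
    _ = 4 ^ d := ENNReal.rpow_one _

/-- `m` approximates `f` in `L_q(S)` with error at most `e`. -/
def ApproxOn (f : (Fin d → ℝ) → ℝ) (q : ℝ≥0∞) (m : MvPolynomial (Fin d) ℝ)
    (S : Set (Fin d → ℝ)) (e : ℝ≥0∞) : Prop :=
  eLpNorm (fun x => f x - MvPolynomial.eval x m) q (volume.restrict S) ≤ e

lemma ApproxOn.mono {f : (Fin d → ℝ) → ℝ} {q : ℝ≥0∞} {m : MvPolynomial (Fin d) ℝ}
    {S S' : Set (Fin d → ℝ)} {e e' : ℝ≥0∞} (h : ApproxOn f q m S e) (hS : S' ⊆ S) (he : e ≤ e') :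
    ApproxOn f q m S' e' :=
  (eLpNorm_mono_measure _ (Measure.restrict_mono hS le_rfl)).trans (h.trans he)

/-- Approximation propagates from a cube to a shifted cube with a large overlap. -/
lemma exists_approxOn_shift (d l : ℕ) : ∃ D : ℝ≥0∞, D ≠ ∞ ∧ 1 ≤ D ∧
    ∀ (f : (Fin d → ℝ) → ℝ) (q : ℝ≥0∞), 1 ≤ q → ∀ (a a' : Fin d → ℝ) (g : ℝ), 0 < g →
      (∀ i, |a i - a' i| ≤ g / 2) →
      AEStronglyMeasurable f (volume.restrict (box a' g)) →
      ∀ (m m' : MvPolynomial (Fin d) ℝ), m.totalDegree ≤ l → m'.totalDegree ≤ l →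
      ∀ e : ℝ≥0∞, ApproxOn f q m (box a g) e → ApproxOn f q m' (box a' g) e →
        ApproxOn f q m (box a' g) (D * e) := by
  obtain ⟨C, hCt, hC⟩ := exists_eLpNorm_eval_le d l
  refine ⟨1 + C * 2, by finiteness, le_self_add, ?_⟩
  intro f q hq a a' g hg haa' hf m m' hm hm' e he he'
  -- The cube of side g/2 at the coordinatewise maximum of the corners lies in both cubes; there m
  -- and m' differ by at most 2e.
  set b : Fin d → ℝ := fun i => max (a i) (a' i)
  have hba : box b (g / 2) ⊆ box a g := fun x hx i => by
    have := hx i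
    have h2 := abs_le.mp (haa' i)
    have h3 : a i ≤ b i := le_max_left _ _
    have h4 : b i ≤ a i + g / 2 := max_le (by linarith) (by linarith)
    constructor <;> linarith
  have hba' : box b (g / 2) ⊆ box a' g := fun x hx i => by
    have := hx i
    have h2 := abs_le.mp (haa' i)
    have h3 : a' i ≤ b i := le_max_right _ _
    have h4 : b i ≤ a' i + g / 2 := max_le (by linarith) (by linarith)
    constructor <;> linarith
  have hnear : ∀ x ∈ box a' g, ∀ i, |x i - b i| ≤ 2 * (g / 2) := fun x hx i => by
    have := hx i
    have h2 := abs_le.mp (haa' i)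
    have h3 : a' i ≤ b i := le_max_right _ _
    have h4 : b i ≤ a' i + g / 2 := max_le (by linarith) (by linarith)
    rw [abs_le]
    constructor <;> linarith
  have hmeas : ∀ (n : MvPolynomial (Fin d) ℝ) (S : Set (Fin d → ℝ)), S ⊆ box a' g →
      AEStronglyMeasurable (fun x => f x - MvPolynomial.eval x n) (volume.restrict S) :=
    fun n S hS => (hf.mono_measure (Measure.restrict_mono hS le_rfl)).sub
      (continuous_eval n).aestronglyMeasurable
  have hdeg : (m' - m).totalDegree ≤ l :=
    (MvPolynomial.totalDegree_sub _ _).trans (max_le hm' hm)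
  have h1 := hC q hq (m' - m) hdeg b (g / 2) (by linarith) (box a' g) (measurableSet_box _ _) hnear
  have h2 : eLpNorm (fun x => MvPolynomial.eval x (m' - m)) q (volume.restrict (box b (g / 2))) ≤
      e + e := by
    have : (fun x => MvPolynomial.eval x (m' - m)) =
        (fun x => f x - MvPolynomial.eval x m) - (fun x => f x - MvPolynomial.eval x m') := by
      ext x; simp
    rw [this]
    exact (eLpNorm_sub_le (hmeas _ _ hba') (hmeas _ _ hba') hq).trans
      (add_le_add (he.mono hba le_rfl) (he'.mono hba' le_rfl))
  have : (fun x => f x - MvPolynomial.eval x m) =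
      (fun x => f x - MvPolynomial.eval x m') + (fun x => MvPolynomial.eval x (m' - m)) := by
    ext x; simp
  rw [ApproxOn, this]
  refine (eLpNorm_add_le (hmeas _ _ subset_rfl)
    (continuous_eval _).aestronglyMeasurable hq).trans ?_
  calc _ ≤ e + C * (e + e) := add_le_add he' (h1.trans (by gcongr))
    _ = (1 + C * 2) * e := by ring

/-! ### Approximation on boxes of bounded eccentricity -/

/-- The half-open box `∏ᵢ [cᵢ, cᵢ + Lᵢ)`. -/
def rect (c L : Fin d → ℝ) : Set (Fin d → ℝ) :=
  {x | ∀ i, c i ≤ x i ∧ x i < c i + L i}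

/-- The six left ends are equally spaced from c to c + L - g with step (L - g)/5 ≤ g, so the
intervals leave no hole. -/
lemma exists_fin_shift {c L g x : ℝ} (h2 : L ≤ 6 * g) (hx : c ≤ x)
    (hx' : x < c + L) :
    ∃ r : Fin 6, c + r * ((L - g) / 5) ≤ x ∧ x < c + r * ((L - g) / 5) + g := by
  by_contra! hcon
  have e0 := hcon 0
  have e1 := hcon 1
  have e2 := hcon 2
  have e3 := hcon 3
  have e4 := hcon 4
  have e5 := hcon 5
  norm_num at e0 e1 e2 e3 e4 e5
  have e0 := e0 hx
  have e1 := e1 (by linarith)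
  have e2 := e2 (by linarith)
  have e3 := e3 (by linarith)
  have e4 := e4 (by linarith)
  have e5 := e5 (by linarith)
  linarith

/-- Approximation propagates from a cube to a box of bounded eccentricity that contains it,
when `f` is well approximable on all cubes of that size in the box. -/
lemma exists_approxOn_rect (d l : ℕ) : ∃ C : ℝ≥0∞, C ≠ ∞ ∧ 1 ≤ C ∧
    ∀ (f : (Fin d → ℝ) → ℝ) (q : ℝ≥0∞), 1 ≤ q → ∀ (c L : Fin d → ℝ) (g : ℝ), 0 < g →
      (∀ i, g ≤ L i ∧ L i ≤ 6 * g) →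
      AEStronglyMeasurable f (volume.restrict (rect c L)) → ∀ e : ℝ≥0∞,
      (∀ a, box a g ⊆ rect c L →
        ∃ m : MvPolynomial (Fin d) ℝ, m.totalDegree ≤ l ∧ ApproxOn f q m (box a g) e) →
      ∀ (a₀ : Fin d → ℝ) (m : MvPolynomial (Fin d) ℝ), m.totalDegree ≤ l →
        (∀ i, c i ≤ a₀ i ∧ a₀ i + g ≤ c i + L i) → ApproxOn f q m (box a₀ g) e →
        ApproxOn f q m (rect c L) (C * e) := by
  obtain ⟨D, hDt, hD1, hD⟩ := exists_approxOn_shift d l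
  refine ⟨6 ^ d * D ^ 10, by finiteness,
    one_le_mul (one_le_pow₀ (by norm_num)) (one_le_pow₀ hD1), ?_⟩
  intro f q hq c L g hg hL hf e hE a₀ m hm ha₀ hm₀
  have hfit : ∀ a : Fin d → ℝ, (∀ i, c i ≤ a i ∧ a i + g ≤ c i + L i) → box a g ⊆ rect c L :=
    fun a ha x hx i => ⟨(ha i).1.trans (hx i).1, (hx i).2.trans_le (ha i).2⟩
  have hpath : ∀ a : Fin d → ℝ, (∀ i, c i ≤ a i ∧ a i + g ≤ c i + L i) →
      ApproxOn f q m (box a g) (D ^ 10 * e) := by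
    intro a ha
    -- Corners move along a straight segment. Each coordinate moves by at most L - g ≤ 5g in all, so
    -- ten steps have length at most g/2 each.
    set P : ℕ → Fin d → ℝ := fun r i => a₀ i + (r / 10 : ℝ) * (a i - a₀ i) with hP
    have hPfit : ∀ r ≤ 10, ∀ i, c i ≤ P r i ∧ P r i + g ≤ c i + L i := by
      intro r hr i
      have hr' : (r : ℝ) / 10 ≤ 1 := by
        rw [div_le_one (by norm_num)]
        exact_mod_cast hr
      have hr0 : (0 : ℝ) ≤ r / 10 := by positivity
      have := ha i
      have := ha₀ i
      simp only [hP]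
      constructor <;> nlinarith
    have hind : ∀ r ≤ 10, ApproxOn f q m (box (P r) g) (D ^ r * e) := by
      intro r
      induction r with
      | zero =>
        intro _
        have : P 0 = a₀ := by ext i; simp [hP]
        simpa [this] using hm₀
      | succ r ih =>
        intro hr
        obtain ⟨m', hm', hm'e⟩ := hE (P (r + 1)) (hfit _ (hPfit _ hr))
        rw [pow_succ', mul_assoc]
        refine hD f q hq (P r) (P (r + 1)) g hg (fun i => ?_)
          (hf.mono_measure (Measure.restrict_mono (hfit _ (hPfit _ hr)) le_rfl)) m m' hm hm' _
          (ih (by omega)) (hm'e.mono subset_rfl (le_mul_of_one_le_left' (one_le_pow₀ hD1)))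
        have h1 := ha i
        have h2 := ha₀ i
        have h3 := hL i
        have : P r i - P (r + 1) i = (a₀ i - a i) / 10 := by
          simp only [hP]; push_cast; ring
        rw [this, abs_le]
        constructor <;> linarith
    have : P 10 = a := by ext i; simp [hP]
    simpa [this] using hind 10 le_rfl
  let S : (Fin d → Fin 6) → Set (Fin d → ℝ) :=
    fun r => box (fun i => c i + (r i : ℝ) * ((L i - g) / 5)) g
  have hcover : rect c L ⊆ ⋃ r ∈ (Finset.univ : Finset (Fin d → Fin 6)), S r := by
    intro x hx
    choose r hr using fun i => exists_fin_shift (hL i).2 (hx i).1 (hx i).2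
    simp only [Finset.mem_univ, Set.iUnion_true, Set.mem_iUnion]
    exact ⟨r, hr⟩
  have := eLpNorm_biUnion_le_card_mul (μ := volume)
    (F := fun x => f x - MvPolynomial.eval x m) hq Finset.univ S (e := D ^ 10 * e) fun r _ => ?_
  · refine (eLpNorm_mono_measure _ (Measure.restrict_mono hcover le_rfl)).trans (this.trans ?_)
    rw [mul_assoc]
    simp
  · refine hpath _ fun i => ?_
    have h3 := hL i
    have h4 : ((r i : ℕ) : ℝ) ≤ 5 := by exact_mod_cast Nat.lt_succ_iff.mp (r i).2
    have h5 : (0 : ℝ) ≤ ((r i : ℕ) : ℝ) := by positivity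
    constructor <;> nlinarith

section

/-! ### Approximation on the difference of two cubes -/

/-- The distance between the inner interval `[b, b + h)` and the upper (`true`) or lower (`false`)
end of the outer interval `[a, a + H)`. -/
def gap (a H b h : ℝ) (σ : Bool) : ℝ :=
  if σ then a + H - (b + h) else b - a

/-- The left end of the interval of length `r` adjacent to `[b, b + h)` from above (`true`) or from
below (`false`). -/
def adjStart (b h : ℝ) (σ : Bool) (r : ℝ) : ℝ :=
  if σ then b + h else b - r

/-- Lower corner of the part of `box a H` lying beyond the face `(i, σ)` of `box b h`, at distance
at most the gap in that direction. -/
def sideCorner (a : Fin d → ℝ) (H : ℝ) (b : Fin d → ℝ) (h : ℝ) (i : Fin d) (σ : Bool) :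
    Fin d → ℝ := fun j =>
  if j = i then adjStart (b i) h σ (gap (a i) H (b i) h σ)
  else max (a j) (b j - gap (a i) H (b i) h σ)

/-- Side lengths of the part of `box a H` lying beyond the face `(i, σ)` of `box b h`, at distance
at most the gap in that direction. -/
def sideLength (a : Fin d → ℝ) (H : ℝ) (b : Fin d → ℝ) (h : ℝ) (i : Fin d) (σ : Bool) :
    Fin d → ℝ := fun j =>
  if j = i then gap (a i) H (b i) h σ
  else min (a j + H) (b j + h + gap (a i) H (b i) h σ) - sideCorner a H b h i σ j

variable {a b : Fin d → ℝ} {H h : ℝ}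

lemma side_subset (hlo : ∀ i, a i ≤ b i) (hup : ∀ i, b i + h ≤ a i + H) (hh : 0 < h)
    (i : Fin d) (σ : Bool) :
    rect (sideCorner a H b h i σ) (sideLength a H b h i σ) ⊆ box a H \ box b h := by
  intro x hx
  have hi := hx i
  have := hlo i
  have := hup i
  constructor
  · intro j
    rcases eq_or_ne j i with rfl | hj
    · cases σ <;> simp [sideCorner, sideLength, adjStart, gap] at hi <;>
        constructor <;> linarith
    · have hxj := hx j
      simp only [sideLength, sideCorner, if_neg hj, add_sub_cancel, max_le_iff,
        lt_min_iff] at hxj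
      exact ⟨hxj.1.1, hxj.2.1⟩
  · intro hxb
    have hbi := hxb i
    cases σ <;> simp [sideCorner, sideLength, adjStart, gap] at hi <;> linarith

/-- Among the faces of the inner cube beyond which x lies, take one with the largest gap. An
excursion of x past another face is at most the gap there, hence at most the chosen gap. -/
lemma subset_iUnion_side :
    box a H \ box b h ⊆ ⋃ s ∈ (Finset.univ : Finset (Fin d × Bool)),
      rect (sideCorner a H b h s.1 s.2) (sideLength a H b h s.1 s.2) := by
  classical
  rintro x ⟨hxa, hxb⟩
  let beyond : Fin d × Bool → Prop := fun s => if s.2 then b s.1 + h ≤ x s.1 else x s.1 < b s.1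
  have hne : (Finset.univ.filter beyond).Nonempty := by
    simp only [box, Set.mem_ofPred_eq, not_forall, not_and_or, not_le, not_lt] at hxb
    obtain ⟨i, hi | hi⟩ := hxb
    · exact ⟨(i, false), by simpa [beyond] using hi⟩
    · exact ⟨(i, true), by simpa [beyond] using hi⟩
  obtain ⟨⟨i, σ⟩, his, hmax⟩ := Finset.exists_max_image _
    (fun s : Fin d × Bool => gap (a s.1) H (b s.1) h s.2) hne
  simp only [Finset.mem_filter, Finset.mem_univ, true_and] at his hmax
  simp only [Finset.mem_univ, Set.iUnion_true, Set.mem_iUnion]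
  refine ⟨(i, σ), fun j => ?_⟩
  have hxj := hxa j
  rcases eq_or_ne j i with rfl | hj
  · cases σ <;> simp [beyond] at his <;> simp [sideCorner, sideLength, adjStart, gap] <;>
      constructor <;> linarith
  · simp only [sideLength, sideCorner, if_neg hj, add_sub_cancel, max_le_iff, lt_min_iff]
    refine ⟨⟨hxj.1, ?_⟩, hxj.2, ?_⟩
    · by_contra! hlt
      by_cases hb : x j < b j
      · have := hmax (j, false) (by simpa [beyond] using hb)
        simp only [gap] at this hlt
        simp at this
        linarith
      · have hbi : gap (a i) H (b i) h σ < 0 := by linarith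
        have hxi := hxa i
        cases σ <;> simp [beyond] at his <;> simp [gap] at hbi <;> linarith
    · by_contra! hlt
      by_cases hb : b j + h ≤ x j
      · have := hmax (j, true) (by simpa [beyond] using hb)
        simp only [gap] at this hlt
        simp at this
        linarith
      · have hbi : gap (a i) H (b i) h σ < 0 := by linarith
        have hxi := hxa i
        cases σ <;> simp [beyond] at his <;> simp [gap] at hbi <;> linarith

/-- A cube touching the inner cube at a corner fits into the sides adjacent to that corner. -/
lemma adjStart_fits (hlo : ∀ i, a i ≤ b i) (hup : ∀ i, b i + h ≤ a i + H) (hh : 0 < h)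
    (τ : Fin d → Bool) {r : ℝ} (hr : 0 ≤ r) (hrg : ∀ j, r ≤ gap (a j) H (b j) h (τ j)) (i j : Fin d) :
    sideCorner a H b h i (τ i) j ≤ adjStart (b j) h (τ j) r ∧
      adjStart (b j) h (τ j) r + r ≤
        sideCorner a H b h i (τ i) j + sideLength a H b h i (τ i) j := by
  have h1 := hlo j
  have h2 := hup j
  have h3 := hrg j
  have h4 := hrg i
  rcases eq_or_ne j i with rfl | hj
  · simp only [sideCorner, sideLength, if_true]
    cases hτ : τ j <;> simp [hτ, adjStart, gap] at h3 ⊢ <;> linarith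
  · simp only [sideLength, add_sub_cancel, sideCorner, if_neg hj, max_le_iff, le_min_iff]
    cases hτ : τ j <;> simp [hτ, adjStart, gap] at h3 ⊢ <;>
      simp only [gap] at h4 <;> refine ⟨⟨?_, ?_⟩, ?_, ?_⟩ <;> linarith

/-- Laterally a side extends over at most h + 2g, where g is the gap; with h ≤ g this is 3g, which
bounds the eccentricity. -/
lemma sideLength_bounds (hlo : ∀ i, a i ≤ b i) (hup : ∀ i, b i + h ≤ a i + H) (hh : 0 < h)
    (i : Fin d) (σ : Bool) (hg : h ≤ gap (a i) H (b i) h σ) (j : Fin d) :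
    gap (a i) H (b i) h σ ≤ sideLength a H b h i σ j ∧
      sideLength a H b h i σ j ≤ 3 * gap (a i) H (b i) h σ := by
  have h1 := hlo j
  have h2 := hup j
  have h3 := hlo i
  have h4 := hup i
  have h5 : gap (a i) H (b i) h σ ≤ H - h := by
    cases σ <;> simp [gap] <;> linarith
  rcases eq_or_ne j i with rfl | hj
  · simp only [sideLength, if_true]
    constructor <;> linarith
  · simp only [sideLength, sideCorner, if_neg hj]
    set g := gap (a i) H (b i) h σ
    constructor
    · rw [le_sub_iff_add_le, le_min_iff, ← le_sub_iff_add_le', ← le_sub_iff_add_le', max_le_iff,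
        max_le_iff]
      refine ⟨⟨?_, ?_⟩, ?_, ?_⟩ <;> linarith
    · have := min_le_right (a j + H) (b j + h + g)
      have := le_max_right (a j) (b j - g)
      linarith

/-- In dimension at least two, `f` is approximable on the difference of two nested cubes as well as
it is on the cubes contained in this difference, provided that the inner cube is not too close to
the faces of the outer one that it does not touch. -/
lemma exists_approxOn_diff (d l : ℕ) (hd : 2 ≤ d) : ∃ C : ℝ≥0∞, C ≠ ∞ ∧
    ∀ (f : (Fin d → ℝ) → ℝ) (q : ℝ≥0∞), 1 ≤ q → ∀ (a b : Fin d → ℝ) (H h : ℝ), 0 < h → 2 * h ≤ H →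
      (∀ i, a i ≤ b i) → (∀ i, b i + h ≤ a i + H) →
      (∀ i σ, gap (a i) H (b i) h σ = 0 ∨ h ≤ gap (a i) H (b i) h σ) →
      AEStronglyMeasurable f (volume.restrict (box a H)) → ∀ e : ℝ≥0∞,
      (∀ x r, 0 < r → box x r ⊆ box a H \ box b h →
        ∃ m : MvPolynomial (Fin d) ℝ, m.totalDegree ≤ l ∧ ApproxOn f q m (box x r) e) →
      ∃ m : MvPolynomial (Fin d) ℝ, m.totalDegree ≤ l ∧
        ApproxOn f q m (box a H \ box b h) (C * e) := by
  obtain ⟨C, hCt, hC1, hC⟩ := exists_approxOn_rect d l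
  refine ⟨(2 * d : ℕ) * (C * C), by finiteness, ?_⟩
  intro f q hq a b H h hh hH hlo hup hgap hf e hE
  set γ : ℝ := (H - h) / 2 with hγ
  have hγ0 : 0 < γ := by linarith
  have hsum : ∀ i σ, gap (a i) H (b i) h (!σ) = 2 * γ - gap (a i) H (b i) h σ := by
    intro i σ
    cases σ <;> simp [gap, hγ] <;> ring
  have hgnn : ∀ i σ, 0 ≤ gap (a i) H (b i) h σ := fun i σ => by
    rcases hgap i σ with h1 | h1 <;> linarith
  -- The two gaps in direction i add up to H - h = 2γ. The cube of side γ at the corner `σ` lies in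
  -- all d sides with large gap, so one polynomial serves them all.
  have hbig : ∀ i, ∃ σ, γ ≤ gap (a i) H (b i) h σ := by
    intro i
    by_contra! hcon
    have h1 := hcon true
    have h2 := hcon false
    have h3 := hsum i true
    simp only [Bool.not_true] at h3
    linarith
  choose σ hσ using hbig
  have hf' : ∀ i τ, AEStronglyMeasurable f
      (volume.restrict (rect (sideCorner a H b h i τ) (sideLength a H b h i τ))) := fun i τ =>
    hf.mono_measure (Measure.restrict_mono
      ((side_subset hlo hup hh i τ).trans Set.sdiff_subset) le_rfl)
  have hfitbox : ∀ {i : Fin d} {τ : Bool} {x : Fin d → ℝ} {r : ℝ},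
      (∀ j, sideCorner a H b h i τ j ≤ x j ∧
        x j + r ≤ sideCorner a H b h i τ j + sideLength a H b h i τ j) →
      box x r ⊆ rect (sideCorner a H b h i τ) (sideLength a H b h i τ) :=
    fun hfit y hy j => ⟨(hfit j).1.trans (hy j).1, (hy j).2.trans_le (hfit j).2⟩
  obtain ⟨i₀⟩ : Nonempty (Fin d) := ⟨⟨0, by omega⟩⟩
  have hub := fun i j => adjStart_fits hlo hup hh σ hγ0.le hσ i j
  obtain ⟨m, hm, hme⟩ := hE (fun j => adjStart (b j) h (σ j) γ) γ hγ0
    ((hfitbox (hub i₀)).trans (side_subset hlo hup hh _ _))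
  have hlarge : ∀ i, ApproxOn f q m
      (rect (sideCorner a H b h i (σ i)) (sideLength a H b h i (σ i))) (C * e) := by
    intro i
    have h1 := hσ i
    have hg : h ≤ gap (a i) H (b i) h (σ i) := by
      rcases hgap i (σ i) with h2 | h2
      · linarith
      · exact h2
    have h3 : gap (a i) H (b i) h (σ i) ≤ 2 * γ := by
      have := hsum i (σ i)
      have := hgnn i (!σ i)
      linarith
    refine hC f q hq _ _ γ hγ0 (fun j => ?_) (hf' i (σ i)) e
      (fun x hx => hE x γ hγ0 (hx.trans (side_subset hlo hup hh _ _))) _ m hm (hub i) hme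
    have := sideLength_bounds hlo hup hh i (σ i) hg j
    constructor <;> linarith
  have hsmall : ∀ i, ApproxOn f q m
      (rect (sideCorner a H b h i (!σ i)) (sideLength a H b h i (!σ i))) (C * (C * e)) := by
    intro i
    rcases hgap i (!σ i) with h0 | hg
    · have : rect (sideCorner a H b h i (!σ i)) (sideLength a H b h i (!σ i)) = ∅ := by
        refine Set.eq_empty_of_forall_notMem fun x hx => ?_
        have := hx i
        simp only [sideCorner, sideLength, if_true, h0, add_zero] at this
        linarith
      simp [ApproxOn, this]
    · set g := gap (a i) H (b i) h (!σ i) with hgdef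
      have hg0 : 0 < g := by linarith
      have hgγ : g ≤ γ := by
        have := hsum i (σ i)
        have := hσ i
        linarith
      -- This is where d ≥ 2 is needed. Reversing only direction i gives a corner cube that lies in
      -- the small side i and also in the large side of another direction j, where m is already
      -- known to be good.
      have : Nontrivial (Fin d) := Fin.nontrivial_iff_two_le.mpr hd
      obtain ⟨j, hj⟩ := exists_ne i
      set τ := Function.update σ i (!σ i) with hτ
      have hτi : τ i = !σ i := by simp [hτ]
      have hτj : τ j = σ j := by simp [hτ, hj]
      have hfit := fun i' => adjStart_fits hlo hup hh τ hg0.le (fun j' => by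
        rcases eq_or_ne j' i with rfl | hne
        · rw [hτi]
        · rw [hτ, Function.update_of_ne hne]
          exact hgγ.trans (hσ j')) i'
      have hfiti := hfit i
      have hfitj := hfit j
      rw [hτi] at hfiti
      rw [hτj] at hfitj
      refine hC f q hq _ _ g hg0 (fun j' => ?_) (hf' i (!σ i)) (C * e)
        (fun x hx => ?_) _ m hm hfiti ((hlarge j).mono (hfitbox hfitj) le_rfl)
      · have := sideLength_bounds hlo hup hh i (!σ i) hg j'
        constructor <;> linarith
      · obtain ⟨m', hm', hme'⟩ := hE x g hg0 (hx.trans (side_subset hlo hup hh _ _))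
        exact ⟨m', hm', hme'.mono subset_rfl (le_mul_of_one_le_left' hC1)⟩
  refine ⟨m, hm, ?_⟩
  have hall : ∀ s ∈ (Finset.univ : Finset (Fin d × Bool)), ApproxOn f q m
      (rect (sideCorner a H b h s.1 s.2) (sideLength a H b h s.1 s.2)) (C * (C * e)) := by
    rintro ⟨i, τ⟩ -
    by_cases hτ : τ = σ i
    · subst hτ
      exact (hlarge i).mono subset_rfl (le_mul_of_one_le_left' hC1)
    · have : τ = !σ i := by simpa [Bool.eq_not] using hτ
      subst this
      exact hsmall i
  have := eLpNorm_biUnion_le_card_mul (μ := volume) hq Finset.univ _ hall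
  refine (eLpNorm_mono_measure _ (Measure.restrict_mono subset_iUnion_side le_rfl)).trans
    (this.trans (le_of_eq ?_))
  simp only [Finset.card_univ, Fintype.card_prod, Fintype.card_fin, Fintype.card_bool]
  push_cast
  ring

end

/-! ### Dyadic cubes and rings -/

/-- The dyadic cube `2^{-j}([0,1)^d + α)`, not necessarily inside the unit cube. -/
def dyadic (j : ℕ) (α : Fin d → ℤ) : Set (Fin d → ℝ) :=
  box (fun i => (α i : ℝ) / 2 ^ j) (1 / 2 ^ j)

/-- In terms of floors, nesting and disjointness of dyadic cubes become integer arithmetic. -/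
lemma mem_dyadic {j : ℕ} {α : Fin d → ℤ} {x : Fin d → ℝ} :
    x ∈ dyadic j α ↔ ∀ i, ⌊2 ^ j * x i⌋ = α i := by
  refine forall_congr' fun i => ?_
  have h : (0 : ℝ) < 2 ^ j := by positivity
  rw [Int.floor_eq_iff, ← add_div, div_le_iff₀' h, lt_div_iff₀' h]

lemma unitCube_eq_dyadic : unitCube d = dyadic 0 0 := by
  simp [unitCube, dyadic, Pi.zero_def]

lemma isDyadicCube_unitCube : IsDyadicCube (unitCube d) :=
  ⟨subset_rfl, 0, 0, unitCube_eq_dyadic⟩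

/-- The children of a dyadic cube. -/
def child (j : ℕ) (α : Fin d → ℤ) (ε : Fin d → Bool) : Set (Fin d → ℝ) :=
  dyadic (j + 1) fun i => 2 * α i + (if ε i then 1 else 0)

lemma floor_two_mul_div (x : ℝ) : ⌊2 * x⌋ / 2 = ⌊x⌋ := by
  have := Int.floor_div_natCast (2 * x) 2
  simpa using this.symm

lemma iUnion_child (j : ℕ) (α : Fin d → ℤ) : ⋃ ε, child j α ε = dyadic j α := by
  ext x
  simp only [Set.mem_iUnion, child, mem_dyadic]
  have key : ∀ i, ⌊(2 : ℝ) ^ (j + 1) * x i⌋ / 2 = ⌊2 ^ j * x i⌋ := fun i => by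
    rw [pow_succ', mul_assoc, floor_two_mul_div]
  constructor
  · rintro ⟨ε, hε⟩ i
    rw [← key, hε i]
    split_ifs <;> omega
  · intro hx
    -- The child is read off from the last binary digits of the finer index.
    refine ⟨fun i => decide (⌊(2 : ℝ) ^ (j + 1) * x i⌋ % 2 = 1), fun i => ?_⟩
    have := key i
    rw [hx i] at this
    by_cases h : ⌊(2 : ℝ) ^ (j + 1) * x i⌋ % 2 = 1 <;> simp only [h, decide_true, decide_false,
      if_true, if_false, Bool.false_eq_true] <;> omega

lemma child_subset (j : ℕ) (α : Fin d → ℤ) (ε : Fin d → Bool) : child j α ε ⊆ dyadic j α := by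
  rw [← iUnion_child]
  exact Set.subset_iUnion _ ε

lemma disjoint_child (j : ℕ) (α : Fin d → ℤ) {ε ε' : Fin d → Bool} (h : ε ≠ ε') :
    Disjoint (child j α ε) (child j α ε') := by
  rw [Set.disjoint_left]
  intro x hx hx'
  refine h (funext fun i => ?_)
  have h1 := mem_dyadic.mp hx i
  rw [mem_dyadic.mp hx' i] at h1
  by_cases e : ε i <;> by_cases e' : ε' i <;> simp_all

lemma box_subset_box {a b : Fin d → ℝ} {H h : ℝ} (hh : 0 < h) (hs : box b h ⊆ box a H)
    (i : Fin d) : a i ≤ b i ∧ b i + h ≤ a i + H := by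
  have hb : b ∈ box b h := fun i => ⟨le_rfl, by linarith⟩
  refine ⟨(hs hb i).1, ?_⟩
  by_contra! hlt
  have hx : Function.update b i (max (b i) (a i + H)) ∈ box b h := by
    intro j
    rcases eq_or_ne j i with rfl | hj
    · simp [hh, hlt]
    · simp [hj, hh]
  have := (hs hx i).2
  simp at this

/-- Both cubes of a ring lie on the grid of mesh h, the side of the inner one. Hence every gap is a
nonnegative integer multiple of h, so it is 0 or at least h, as `exists_approxOn_diff` requires. -/
lemma exists_approxOn_ring (d k : ℕ) (hd : 2 ≤ d) : ∃ C : ℝ≥0∞, C ≠ ∞ ∧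
    ∀ (f : (Fin d → ℝ) → ℝ) (q : ℝ≥0∞), 1 ≤ q → MemLp f q (volume.restrict (unitCube d)) →
      ∀ R : Set (Fin d → ℝ), IsDyadicRing R → ∀ e : ℝ≥0∞,
      (∀ K, IsCube K → K ⊆ R → bestApprox k f K q ≤ e) →
      ∃ m : MvPolynomial (Fin d) ℝ, m.totalDegree ≤ k - 1 ∧ ApproxOn f q m R (C * e) := by
  obtain ⟨C, hCt, hC⟩ := exists_approxOn_diff d (k - 1) hd
  refine ⟨max 2 (C * 2), by simp [ENNReal.mul_ne_top hCt], ?_⟩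
  intro f q hq hf R hR e he
  have hbest : ∀ x r, 0 < r → box x r ⊆ R → R ⊆ unitCube d →
      ∃ m : MvPolynomial (Fin d) ℝ, m.totalDegree ≤ k - 1 ∧ ApproxOn f q m (box x r) (2 * e) := by
    intro x r hr hx hRu
    obtain ⟨m, hm, hme⟩ := exists_poly_eLpNorm_le (k := k) hq
      (hf.mono_measure (Measure.restrict_mono (hx.trans hRu) le_rfl))
    refine ⟨m, hm, hme.trans ?_⟩
    gcongr
    exact he _ ⟨x, r, hr, rfl⟩ hx
  rcases hR with ⟨hRu, j, α, rfl⟩ | ⟨_, _, ⟨hQu, j, α, rfl⟩, ⟨-, j', α', rfl⟩, hss, rfl⟩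
  · obtain ⟨m, hm, hme⟩ := hbest _ _ (by positivity) subset_rfl hRu
    exact ⟨m, hm, hme.mono subset_rfl (by gcongr; exact le_max_left _ _)⟩
  · have hh : (0 : ℝ) < 1 / 2 ^ j' := by positivity
    have hsub := box_subset_box hh hss.subset
    have hjj : j < j' := by
      by_contra! hle
      have h1 : (1 : ℝ) / 2 ^ j ≤ 1 / 2 ^ j' :=
        one_div_le_one_div_of_le (by positivity) (pow_le_pow_right₀ (by norm_num) hle)
      refine hss.not_subset fun x hx i => ?_
      have h2 := hsub i
      have h3 := hx i
      constructor <;> linarith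
    obtain ⟨n, rfl⟩ : ∃ n, j' = j + (n + 1) := ⟨j' - j - 1, by omega⟩
    set h : ℝ := 1 / 2 ^ (j + (n + 1)) with hhdef
    have hH : (1 : ℝ) / 2 ^ j = 2 ^ (n + 1) * h := by
      rw [hhdef]
      field_simp
      ring
    have hz : ∀ z : ℤ, 0 ≤ (z : ℝ) * h → (z : ℝ) * h = 0 ∨ h ≤ z * h := by
      intro z hz
      have hz0 : (0 : ℝ) ≤ z := nonneg_of_mul_nonneg_left hz hh
      have hz0' : 0 ≤ z := by exact_mod_cast hz0
      rcases hz0'.eq_or_lt with h0 | h0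
      · left; simp [← h0]
      · right
        have : (1 : ℝ) ≤ z := by exact_mod_cast h0
        nlinarith
    have h2H : 2 * h ≤ 1 / 2 ^ j := by
      have : (1 : ℝ) ≤ 2 ^ n := one_le_pow₀ (by norm_num)
      rw [hH, pow_succ]
      nlinarith
    have hgap : ∀ i σ, gap ((α i : ℝ) / 2 ^ j) (1 / 2 ^ j) ((α' i : ℝ) / 2 ^ (j + (n + 1))) h σ = 0 ∨
        h ≤ gap ((α i : ℝ) / 2 ^ j) (1 / 2 ^ j) ((α' i : ℝ) / 2 ^ (j + (n + 1))) h σ := by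
      intro i τ
      have h1 : (α i : ℝ) / 2 ^ j = (2 ^ (n + 1) * α i) * h := by
        rw [div_eq_mul_one_div, hH]; ring
      have h2 : (α' i : ℝ) / 2 ^ (j + (n + 1)) = α' i * h := by
        rw [div_eq_mul_one_div]
      have hsubi := hsub i
      cases τ
      · have h3 : gap ((α i : ℝ) / 2 ^ j) (1 / 2 ^ j) ((α' i : ℝ) / 2 ^ (j + (n + 1))) h false =
            ((α' i - 2 ^ (n + 1) * α i : ℤ) : ℝ) * h := by
          rw [h1, h2, hH]; simp only [gap]; push_cast; ring
        rw [h3]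
        refine hz _ ?_
        rw [← h3]
        simp only [gap]
        simp only [Bool.false_eq_true, if_false]
        linarith
      · have h3 : gap ((α i : ℝ) / 2 ^ j) (1 / 2 ^ j) ((α' i : ℝ) / 2 ^ (j + (n + 1))) h true =
            ((2 ^ (n + 1) * α i + 2 ^ (n + 1) - α' i - 1 : ℤ) : ℝ) * h := by
          rw [h1, h2, hH]; simp only [gap]; push_cast; ring
        rw [h3]
        refine hz _ ?_
        rw [← h3]
        simp only [gap]
        simp only [if_true]
        linarith
    obtain ⟨m, hm, hme⟩ := hC f q hq _ _ (1 / 2 ^ j) h hh h2H (fun i => (hsub i).1)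
      (fun i => (hsub i).2) hgap
      (hf.aestronglyMeasurable.mono_measure (Measure.restrict_mono hQu le_rfl)) (2 * e)
      (fun x r hr hx => hbest x r hr hx (Set.sdiff_subset.trans hQu))
    refine ⟨m, hm, hme.mono subset_rfl ?_⟩
    rw [← mul_assoc]
    gcongr
    exact le_max_right _ _

/-! ### Decomposition of cubes into rings of small charge -/

/-- `S` is a disjoint union of at most `n` sets with the property `G`. -/
def Decomposes {X : Type*} (G : Set X → Prop) (S : Set X) (n : ℕ) : Prop :=
  ∃ Δ : Finset (Set X), Δ.card ≤ n ∧ (∀ R ∈ Δ, G R) ∧ (Δ : Set (Set X)).PairwiseDisjoint id ∧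
    ⋃ R ∈ Δ, R = S

section Decomposes

variable {X : Type*} {G : Set X → Prop} {S S' : Set X} {n n' : ℕ}

lemma Decomposes.empty (n : ℕ) : Decomposes G ∅ n :=
  ⟨∅, by simp⟩

lemma Decomposes.single (h : G S) : Decomposes G S 1 :=
  ⟨{S}, by simp [h]⟩

lemma Decomposes.union (h : Decomposes G S n) (h' : Decomposes G S' n') (hd : Disjoint S S') :
    Decomposes G (S ∪ S') (n + n') := by
  classical
  obtain ⟨Δ, hc, hG, hp, rfl⟩ := h
  obtain ⟨Δ', hc', hG', hp', rfl⟩ := h'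
  refine ⟨Δ ∪ Δ', (Finset.card_union_le _ _).trans (add_le_add hc hc'), ?_, ?_, ?_⟩
  · intro R hR
    rcases Finset.mem_union.mp hR with h | h
    exacts [hG R h, hG' R h]
  · rw [Finset.coe_union, Set.pairwiseDisjoint_union]
    refine ⟨hp, hp', fun R hR R' hR' _ => ?_⟩
    exact hd.mono (Set.subset_biUnion_of_mem (u := id) hR) (Set.subset_biUnion_of_mem (u := id) hR')
  · rw [Finset.set_biUnion_union]

lemma Decomposes.biUnion {ι : Type*} (s : Finset ι) {T : ι → Set X} {c : ι → ℕ}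
    (hT : ∀ i ∈ s, Decomposes G (T i) (c i)) (hd : Pairwise (Function.onFun Disjoint T)) :
    Decomposes G (⋃ i ∈ s, T i) (∑ i ∈ s, c i) := by
  classical
  induction s using Finset.induction_on with
  | empty => simpa using Decomposes.empty 0
  | insert i s hi ih =>
    rw [Finset.set_biUnion_insert, Finset.sum_insert hi]
    refine (hT i (Finset.mem_insert_self _ _)).union
      (ih fun j hj => hT j (Finset.mem_insert_of_mem hj)) ?_
    simp only [Set.disjoint_iUnion_right]
    exact fun j hj => hd (by rintro rfl; exact hi hj)

end Decomposes

/-- Superadditivity of a set function. -/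
def Superadditive {X : Type*} (ψ : Set X → ℝ≥0∞) : Prop :=
  ∀ S₁ S₂ S : Set X, Disjoint S₁ S₂ → S₁ ⊆ S → S₂ ⊆ S → ψ S₁ + ψ S₂ ≤ ψ S

lemma Superadditive.mono {X : Type*} {ψ : Set X → ℝ≥0∞} (hψ : Superadditive ψ) {S S' : Set X}
    (h : S ⊆ S') : ψ S ≤ ψ S' :=
  le_self_add.trans (hψ S ∅ S' (Set.disjoint_empty _) h (Set.empty_subset _))

lemma Superadditive.sum_le {X ι : Type*} {ψ : Set X → ℝ≥0∞} (hψ : Superadditive ψ) (s : Finset ι)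
    {T : ι → Set X} (hd : Pairwise (Function.onFun Disjoint T)) :
    ∑ i ∈ s, ψ (T i) ≤ ψ (⋃ i ∈ s, T i) := by
  classical
  induction s using Finset.induction_on with
  | empty => simp
  | insert i s hi ih =>
    rw [Finset.set_biUnion_insert, Finset.sum_insert hi]
    refine (add_le_add le_rfl ih).trans
      (hψ _ _ _ ?_ Set.subset_union_left Set.subset_union_right)
    simp only [Set.disjoint_iUnion_right]
    exact fun j hj => hd (by rintro rfl; exact hi hj)

/-- The outer cube Q is where the current ring began, and the dyadic cube inside it is the present
end of the descent. The surplus B = 2^d + 1 in c + B makes the induction close: one cut creates at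
most B pieces beyond those of the heavy children, and two heavy children bring a surplus of 2B. -/
lemma decomposes_dyadic {ψ : Set (Fin d → ℝ) → ℝ≥0∞} (hψ : Superadditive ψ) (t : ℝ≥0∞) (J n : ℕ) :
    ∀ (j : ℕ) (α : Fin d → ℤ), j + n = J → dyadic j α ⊆ unitCube d → t < ψ (dyadic j α) →
      ∀ Q : Set (Fin d → ℝ), IsDyadicCube Q → dyadic j α ⊆ Q → ψ (Q \ dyadic j α) ≤ t →
        ∃ c : ℕ, Decomposes (fun R => IsDyadicRing R ∧ (ψ R ≤ t ∨ ∃ β, R = dyadic J β)) Q c ∧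
          ((c + (2 ^ d + 1) : ℕ) : ℝ≥0∞) * t ≤ ((2 * (2 ^ d + 1) : ℕ) : ℝ≥0∞) * ψ Q := by
  classical
  set G : Set (Fin d → ℝ) → Prop := fun R => IsDyadicRing R ∧ (ψ R ≤ t ∨ ∃ β, R = dyadic J β)
  set B : ℕ := 2 ^ d + 1 with hB
  have hring : ∀ (j : ℕ) (α : Fin d → ℤ), dyadic j α ⊆ unitCube d → ∀ Q, IsDyadicCube Q →
      dyadic j α ⊆ Q → ψ (Q \ dyadic j α) ≤ t → Decomposes G (Q \ dyadic j α) 1 := by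
    intro j α hu Q hQ hsub ht
    -- For equal cubes the difference is empty and is no ring; the empty family then serves.
    rcases hsub.eq_or_ssubset with h | h
    · rw [h, Set.sdiff_self]
      exact Decomposes.empty 1
    · exact Decomposes.single ⟨Or.inr ⟨Q, _, hQ, ⟨hu, j, α, rfl⟩, h, rfl⟩, Or.inl ht⟩
  induction n with
  | zero =>
    intro j α hj hu ht Q hQ hsub hQt
    obtain rfl : j = J := by omega
    have h1 := (hring j α hu Q hQ hsub hQt).union
      (Decomposes.single (S := dyadic j α) ⟨Or.inl ⟨hu, j, α, rfl⟩, Or.inr ⟨α, rfl⟩⟩)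
      Set.disjoint_sdiff_left
    rw [Set.sdiff_union_of_subset hsub] at h1
    refine ⟨1 + 1, h1, ?_⟩
    have h2 : 1 + 1 + B ≤ 2 * B := by
      have : 1 ≤ 2 ^ d := Nat.one_le_two_pow
      omega
    gcongr
    exact ht.le.trans (hψ.mono hsub)
  | succ n ih =>
    intro j α hj hu ht Q hQ hsub hQt
    have hcu : ∀ ε, child j α ε ⊆ unitCube d := fun ε => (child_subset j α ε).trans hu
    have hc : ∀ ε, IsDyadicCube (child j α ε) := fun ε => ⟨hcu ε, j + 1, _, rfl⟩
    have hex : ∀ ε, ∃ c : ℕ, Decomposes G (child j α ε) c ∧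
        (t < ψ (child j α ε) → ((c + B : ℕ) : ℝ≥0∞) * t ≤ ((2 * B : ℕ) : ℝ≥0∞) * ψ (child j α ε)) ∧
        (¬ t < ψ (child j α ε) → c = 1) := by
      intro ε
      by_cases h : t < ψ (child j α ε)
      · obtain ⟨c, hc1, hc2⟩ := ih (j + 1) _ (by omega) (hcu ε) h (child j α ε) (hc ε) subset_rfl
          (by
            change ψ (child j α ε \ child j α ε) ≤ t
            rw [Set.sdiff_self]
            exact (hψ.mono (Set.empty_subset _)).trans hQt)
        exact ⟨c, hc1, fun _ => hc2, fun h' => absurd h h'⟩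
      · exact ⟨1, Decomposes.single ⟨Or.inl (hc ε), Or.inl (not_lt.mp h)⟩,
          fun h' => absurd h' h, fun _ => rfl⟩
    choose c hcD hcbig hcsmall using hex
    set s : Finset (Fin d → Bool) := Finset.univ.filter fun ε => t < ψ (child j α ε)
    have hpd : Pairwise (Function.onFun Disjoint (child j α)) := fun ε ε' h => disjoint_child j α h
    have hD : Decomposes G Q (1 + ∑ ε, c ε) := by
      have h1 := (hring j α hu Q hQ hsub hQt).union
        (S' := dyadic j α) (n' := ∑ ε, c ε) ?_ Set.disjoint_sdiff_left
      · rwa [Set.sdiff_union_of_subset hsub] at h1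
      · have := Decomposes.biUnion Finset.univ (fun ε _ => hcD ε) hpd
        simpa [iUnion_child] using this
    -- The cut costs the ring around the current cube and at most 2^d light children.
    have hcount : 1 + ∑ ε, c ε ≤ B + ∑ ε ∈ s, c ε := by
      rw [← Finset.sum_filter_add_sum_filter_not Finset.univ (fun ε => t < ψ (child j α ε)) c]
      have : ∑ ε with ¬ t < ψ (child j α ε), c ε ≤ 2 ^ d := by
        rw [Finset.sum_congr rfl fun ε hε => hcsmall ε (Finset.mem_filter.mp hε).2]
        simpa using Finset.card_filter_le (Finset.univ : Finset (Fin d → Bool))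
          (fun ε => ¬ t < ψ (child j α ε))
      change 1 + (∑ ε ∈ s, c ε + _) ≤ _
      omega
    have hsum : ((∑ ε ∈ s, (c ε + B) : ℕ) : ℝ≥0∞) * t ≤ ((2 * B : ℕ) : ℝ≥0∞) * ψ Q := by
      rw [Nat.cast_sum, Finset.sum_mul]
      calc _ ≤ ∑ ε ∈ s, ((2 * B : ℕ) : ℝ≥0∞) * ψ (child j α ε) :=
            Finset.sum_le_sum fun ε hε => hcbig ε (Finset.mem_filter.mp hε).2
        _ = ((2 * B : ℕ) : ℝ≥0∞) * ∑ ε ∈ s, ψ (child j α ε) := (Finset.mul_sum _ _ _).symm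
        _ ≤ _ := by
          gcongr
          refine (hψ.sum_le s hpd).trans (hψ.mono ?_)
          exact Set.iUnion₂_subset fun ε _ => (child_subset j α ε).trans hsub
    rw [Finset.sum_add_distrib, Finset.sum_const, smul_eq_mul] at hsum
    rcases Nat.lt_or_ge 1 s.card with h2 | h2
    · refine ⟨_, hD, le_trans ?_ hsum⟩
      have : 1 + ∑ ε, c ε + B ≤ ∑ ε ∈ s, c ε + s.card * B := by nlinarith
      gcongr
    rcases Finset.card_le_one_iff_subset_singleton.mp h2 with ⟨ε, hε⟩
    rcases Finset.subset_singleton_iff.mp hε with h0 | h1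
    · refine ⟨_, hD, ?_⟩
      have : 1 + ∑ ε, c ε + B ≤ 2 * B := by
        rw [h0, Finset.sum_empty] at hcount
        omega
      gcongr
      exact ht.le.trans (hψ.mono hsub)
    · have hεs : t < ψ (child j α ε) := by
        have : ε ∈ s := h1 ▸ Finset.mem_singleton_self ε
        exact (Finset.mem_filter.mp this).2
      have hεQ : child j α ε ⊆ Q := (child_subset j α ε).trans hsub
      by_cases hle : ψ (Q \ child j α ε) ≤ t
      -- No cut is made: the descent passes to the only heavy child with the same Q.
      · exact ih (j + 1) _ (by omega) (hcu ε) hεs Q hQ hεQ hle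
      -- Here Q minus the heavy child has charge above t, which pays for the extra 2B pieces.
      · refine ⟨_, hD, ?_⟩
        rw [h1, Finset.sum_singleton] at hcount
        have h3 : 1 + ∑ ε, c ε + B ≤ 2 * B + (c ε + B) := by omega
        calc _ ≤ ((2 * B + (c ε + B) : ℕ) : ℝ≥0∞) * t := by gcongr
          _ = ((2 * B : ℕ) : ℝ≥0∞) * t + ((c ε + B : ℕ) : ℝ≥0∞) * t := by
            rw [Nat.cast_add, add_mul]
          _ ≤ ((2 * B : ℕ) : ℝ≥0∞) * ψ (Q \ child j α ε) +
              ((2 * B : ℕ) : ℝ≥0∞) * ψ (child j α ε) :=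
            add_le_add (mul_le_mul_right (not_le.mp hle).le _) (hcbig ε hεs)
          _ = ((2 * B : ℕ) : ℝ≥0∞) * (ψ (Q \ child j α ε) + ψ (child j α ε)) := (mul_add _ _ _).symm
          _ ≤ _ := by
            gcongr
            exact hψ _ _ _ Set.disjoint_sdiff_left Set.sdiff_subset hεQ

section

/-! ### The charge of a set -/

/-- The supremum of `∑_{Q ∈ F} E_k(f; Q; L_q)^p` over finite families `F` of pairwise disjoint cubes
contained in `S`. -/
def cubeCharge (k : ℕ) (p : ℝ) (q : ℝ≥0∞) (f : (Fin d → ℝ) → ℝ) (S : Set (Fin d → ℝ)) : ℝ≥0∞ :=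
  ⨆ (F : Finset (Set (Fin d → ℝ)))
    (_ : (∀ Q ∈ F, IsCube Q ∧ Q ⊆ S) ∧ (F : Set (Set (Fin d → ℝ))).PairwiseDisjoint id),
    ∑ Q ∈ F, bestApprox k f Q q ^ p

variable {k : ℕ} {p : ℝ} {q : ℝ≥0∞} {f : (Fin d → ℝ) → ℝ}

lemma IsCube.nonempty {Q : Set (Fin d → ℝ)} (h : IsCube Q) : Q.Nonempty := by
  obtain ⟨a, h, hh, rfl⟩ := h
  exact ⟨a, fun i => ⟨le_rfl, by linarith⟩⟩

/-- Admissible families for disjoint sets unite to an admissible family. No cube is counted twice,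
because cubes are nonempty. -/
lemma superadditive_cubeCharge : Superadditive (cubeCharge k p q f) := by
  classical
  intro S₁ S₂ S hd h₁ h₂
  refine ENNReal.biSup_add_biSup_le' ⟨∅, by simp⟩ ⟨∅, by simp⟩ ?_
  rintro F₁ ⟨hF₁, hp₁⟩ F₂ ⟨hF₂, hp₂⟩
  have hdis : Disjoint F₁ F₂ := by
    rw [Finset.disjoint_left]
    intro Q hQ₁ hQ₂
    obtain ⟨x, hx⟩ := (hF₁ Q hQ₁).1.nonempty
    exact Set.disjoint_left.mp hd ((hF₁ Q hQ₁).2 hx) ((hF₂ Q hQ₂).2 hx)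
  rw [← Finset.sum_union hdis]
  refine le_iSup₂_of_le (F₁ ∪ F₂) ⟨?_, ?_⟩ le_rfl
  · intro Q hQ
    rcases Finset.mem_union.mp hQ with h | h
    exacts [⟨(hF₁ Q h).1, (hF₁ Q h).2.trans h₁⟩, ⟨(hF₂ Q h).1, (hF₂ Q h).2.trans h₂⟩]
  · rw [Finset.coe_union, Set.pairwiseDisjoint_union]
    exact ⟨hp₁, hp₂, fun Q hQ Q' hQ' _ => hd.mono (hF₁ Q hQ).2 (hF₂ Q' hQ').2⟩

lemma cubeCharge_unitCube_le (hp : 0 < p) :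
    cubeCharge k p q f (unitCube d) ≤ seminormV k p q f ^ p := by
  refine iSup₂_le fun F hF => ?_
  rw [← ENNReal.rpow_inv_le_iff hp, ← one_div]
  refine le_trans (le_of_eq ?_) (le_iSup₂_of_le (F : Set (Set (Fin d → ℝ))) hF le_rfl)
  rw [Finset.tsum_subtype' F fun Q => bestApprox k f Q q ^ p]

lemma bestApprox_le_of_subset (hp : 0 < p) {K R : Set (Fin d → ℝ)} (hK : IsCube K) (hKR : K ⊆ R) :
    bestApprox k f K q ≤ cubeCharge k p q f R ^ p⁻¹ := by
  rw [ENNReal.le_rpow_inv_iff hp]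
  refine le_iSup₂_of_le {K} ⟨?_, ?_⟩ (by simp)
  · simpa using ⟨hK, hKR⟩
  · simp

/-! ### Approximation by piecewise constants -/

/-- The index of the dyadic cube of level `J` containing `x`. -/
def dyadicIndex (J : ℕ) (x : Fin d → ℝ) : Fin d → ℤ := fun i => ⌊2 ^ J * x i⌋

lemma measurable_comp_dyadicIndex (J : ℕ) (v : (Fin d → ℤ) → ℝ) :
    Measurable fun x : Fin d → ℝ => v (dyadicIndex J x) := by
  refine (Measurable.of_discrete (f := v)).comp ?_
  refine measurable_pi_lambda _ fun i => ?_
  exact Int.measurable_floor.comp (by fun_prop)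

lemma exists_abs_sub_dyadicIndex_le (hf : UniformContinuousOn f (unitCube d)) {η : ℝ}
    (hη : 0 < η) :
    ∃ (J : ℕ) (v : (Fin d → ℤ) → ℝ), ∀ x ∈ unitCube d, ‖f x - v (dyadicIndex J x)‖ ≤ η := by
  obtain ⟨δ, hδ, hfδ⟩ := Metric.uniformContinuousOn_iff.mp hf η hη
  obtain ⟨J, hJ⟩ := exists_pow_lt_of_lt_one hδ (by norm_num : (1 / 2 : ℝ) < 1)
  have h2 : (0 : ℝ) < 2 ^ J := by positivity
  -- The constant on a cube is the value of f at its lower corner, which lies in the unit cube.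
  refine ⟨J, fun α => f fun i => (α i : ℝ) / 2 ^ J, fun x hx => ?_⟩
  have hy : ∀ i, (⌊2 ^ J * x i⌋ : ℝ) / 2 ^ J ≤ x i := fun i => by
    rw [div_le_iff₀' h2]; exact Int.floor_le _
  have hy' : ∀ i, x i < (⌊2 ^ J * x i⌋ : ℝ) / 2 ^ J + 1 / 2 ^ J := fun i => by
    rw [← add_div, lt_div_iff₀' h2]; exact Int.lt_floor_add_one _
  have hxi := fun i => hx i
  simp only [Pi.zero_apply, zero_add] at hxi
  rw [← dist_eq_norm]
  refine (hfδ x hx _ (fun i => ⟨?_, ?_⟩) ?_).le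
  · have : (0 : ℤ) ≤ ⌊2 ^ J * x i⌋ := Int.floor_nonneg.mpr (mul_nonneg h2.le (hxi i).1)
    have : (0 : ℝ) ≤ ⌊2 ^ J * x i⌋ := by exact_mod_cast this
    simp only [dyadicIndex, Pi.zero_apply]
    positivity
  · simp only [dyadicIndex, Pi.zero_apply, zero_add]
    exact (hy i).trans_lt (hxi i).2
  · rw [dist_pi_lt_iff hδ]
    intro i
    rw [Real.dist_eq, abs_lt]
    have h3 : (1 / 2 : ℝ) ^ J = 1 / 2 ^ J := by simp
    rw [h3] at hJ
    have := hy i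
    have := hy' i
    simp only [dyadicIndex]
    constructor <;> linarith

lemma exists_eLpNorm_sub_dyadicIndex_le_of_uniformContinuousOn
    (hf : UniformContinuousOn f (unitCube d)) {η : ℝ≥0∞} (hη : η ≠ 0) (q : ℝ≥0∞) :
    ∃ (J : ℕ) (v : (Fin d → ℤ) → ℝ),
      eLpNorm (fun x => f x - v (dyadicIndex J x)) q (volume.restrict (unitCube d)) ≤ η := by
  have hm0 : min η 1 ≠ 0 := (lt_min (pos_iff_ne_zero.mpr hη) one_pos).ne'
  have hmt : min η 1 ≠ ∞ := ((min_le_right _ _).trans_lt ENNReal.one_lt_top).ne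
  obtain ⟨J, v, hv⟩ := exists_abs_sub_dyadicIndex_le hf (ENNReal.toReal_pos hm0 hmt)
  refine ⟨J, v, ?_⟩
  have := isProbabilityMeasure_unitCube (d := d)
  have hm : MeasurableSet (unitCube d) := measurableSet_box _ _
  refine (eLpNorm_le_of_ae_bound (C := (min η 1).toReal)
    ((ae_restrict_mem hm).mono fun x hx => hv x hx)).trans ?_
  rw [ENNReal.ofReal_toReal hmt]
  simp

/-- For finite q, continuous functions of compact support are dense in L_q and uniformly continuous,
which reduces the claim to the uniformly continuous case. -/
lemma exists_eLpNorm_sub_dyadicIndex_le (hq : 1 ≤ q)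
    (hf : MemLp f q (volume.restrict (unitCube d)))
    (hfu : q = ∞ → UniformContinuousOn f (unitCube d)) {η : ℝ≥0∞} (hη : η ≠ 0) :
    ∃ (J : ℕ) (v : (Fin d → ℤ) → ℝ),
      eLpNorm (fun x => f x - v (dyadicIndex J x)) q (volume.restrict (unitCube d)) ≤ η := by
  by_cases hqt : q = ∞
  · exact exists_eLpNorm_sub_dyadicIndex_le_of_uniformContinuousOn (hfu hqt) hη q
  have hη2 : η / 2 ≠ 0 := by simpa using hη
  have := isProbabilityMeasure_unitCube (d := d)
  obtain ⟨h, hsupp, hfh, hcont, -⟩ := hf.exists_hasCompactSupport_eLpNorm_sub_le hqt hη2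
  have huc : UniformContinuous h := hsupp.uniformContinuous_of_continuous hcont
  obtain ⟨J, v, hv⟩ := exists_eLpNorm_sub_dyadicIndex_le_of_uniformContinuousOn
    (huc.uniformContinuousOn (s := unitCube d)) hη2 q
  refine ⟨J, v, ?_⟩
  have heq : (fun x => f x - v (dyadicIndex J x)) =
      (f - h) + fun x => h x - v (dyadicIndex J x) := by
    ext x; simp
  rw [heq]
  refine (eLpNorm_add_le (hf.aestronglyMeasurable.sub hcont.aestronglyMeasurable)
    (hcont.aestronglyMeasurable.sub
      (measurable_comp_dyadicIndex J v).aestronglyMeasurable) hq).trans ?_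
  exact (add_le_add hfh hv).trans (ENNReal.add_halves η).le

/-! ### Piecewise polynomials -/

lemma IsPiecewisePoly.add {l : ℕ} {Δ₁ Δ₂ : Finset (Set (Fin d → ℝ))} {g₁ g₂ : (Fin d → ℝ) → ℝ}
    [DecidableEq (Set (Fin d → ℝ))]
    (h₁ : IsPiecewisePoly l Δ₁ g₁) (h₂ : IsPiecewisePoly l Δ₂ g₂) :
    IsPiecewisePoly l (Δ₁ ∪ Δ₂) fun x => g₁ x + g₂ x := by
  obtain ⟨P₁, hP₁, hg₁⟩ := h₁
  obtain ⟨P₂, hP₂, hg₂⟩ := h₂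
  refine ⟨fun K => (if K ∈ Δ₁ then P₁ K else 0) + (if K ∈ Δ₂ then P₂ K else 0), ?_, fun x => ?_⟩
  · intro K _
    refine (MvPolynomial.totalDegree_add _ _).trans (max_le ?_ ?_)
    · split_ifs with h
      exacts [hP₁ K h, by simp]
    · split_ifs with h
      exacts [hP₂ K h, by simp]
  · have key : ∀ (Δ : Finset (Set (Fin d → ℝ))) (P : Set (Fin d → ℝ) → MvPolynomial (Fin d) ℝ),
        Δ ⊆ Δ₁ ∪ Δ₂ → ∑ K ∈ Δ, K.indicator (fun y => MvPolynomial.eval y (P K)) x =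
          ∑ K ∈ Δ₁ ∪ Δ₂,
            K.indicator (fun y => MvPolynomial.eval y (if K ∈ Δ then P K else 0)) x := by
      intro Δ P hΔ
      rw [← Finset.sum_subset hΔ]
      · exact Finset.sum_congr rfl fun K hK => by simp [hK]
      · intro K _ hK
        simp [hK]
    beta_reduce
    rw [hg₁, hg₂, key Δ₁ P₁ Finset.subset_union_left, key Δ₂ P₂ Finset.subset_union_right,
      ← Finset.sum_add_distrib]
    refine Finset.sum_congr rfl fun K _ => ?_
    by_cases hx : x ∈ K <;> simp [hx]

lemma isPiecewisePoly_singleton {l : ℕ} {m : MvPolynomial (Fin d) ℝ} (hm : m.totalDegree ≤ l)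
    (K : Set (Fin d → ℝ)) :
    IsPiecewisePoly l {K} (K.indicator fun y => MvPolynomial.eval y m) :=
  ⟨fun _ => m, fun _ _ => hm, by simp⟩

/-- On a ring, m is placed on the outer cube and -m on the inner one; overlapping pieces are allowed
in a covering. -/
lemma exists_cubes_of_ring {l : ℕ} {m : MvPolynomial (Fin d) ℝ} (hm : m.totalDegree ≤ l)
    {R : Set (Fin d → ℝ)} (hR : IsDyadicRing R) :
    ∃ Δ : Finset (Set (Fin d → ℝ)), (∀ K ∈ Δ, IsDyadicCube K) ∧ Δ.card ≤ 2 ∧ R ⊆ ⋃ K ∈ Δ, K ∧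
      IsPiecewisePoly l Δ (R.indicator fun y => MvPolynomial.eval y m) := by
  classical
  rcases hR with hR | ⟨Q, Q', hQ, hQ', hss, rfl⟩
  · exact ⟨{R}, by simpa using hR, by simp, by simp, isPiecewisePoly_singleton hm R⟩
  · refine ⟨{Q} ∪ {Q'}, ?_, Finset.card_union_le _ _, ?_, ?_⟩
    · intro K hK
      simp only [Finset.mem_union, Finset.mem_singleton] at hK
      rcases hK with rfl | rfl <;> assumption
    · exact fun x hx => Set.mem_biUnion (x := Q) (by simp) hx.1
    · have h := (isPiecewisePoly_singleton hm Q).add (isPiecewisePoly_singleton (m := -m)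
        (by rwa [MvPolynomial.totalDegree_neg]) Q')
      convert h using 1
      ext x
      by_cases h1 : x ∈ Q'
      · simp [h1, hss.subset h1]
      · by_cases h2 : x ∈ Q <;> simp [h1, h2]

lemma exists_cubes_of_rings {l : ℕ} (P : Set (Fin d → ℝ) → MvPolynomial (Fin d) ℝ)
    (Δ : Finset (Set (Fin d → ℝ))) (hP : ∀ R ∈ Δ, (P R).totalDegree ≤ l)
    (hΔ : ∀ R ∈ Δ, IsDyadicRing R) :
    ∃ Δ' : Finset (Set (Fin d → ℝ)), (∀ K ∈ Δ', IsDyadicCube K) ∧ Δ'.card ≤ 2 * Δ.card ∧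
      ⋃ R ∈ Δ, R ⊆ ⋃ K ∈ Δ', K ∧
      IsPiecewisePoly l Δ' fun x => ∑ R ∈ Δ, R.indicator (fun y => MvPolynomial.eval y (P R)) x := by
  classical
  induction Δ using Finset.induction_on with
  | empty => exact ⟨∅, by simp, by simp, by simp, 0, by simp, by simp⟩
  | insert R Δ hR ih =>
    obtain ⟨Δ₁, hc₁, hn₁, hs₁, hp₁⟩ := exists_cubes_of_ring (hP R (Finset.mem_insert_self _ _))
      (hΔ R (Finset.mem_insert_self _ _))
    obtain ⟨Δ₂, hc₂, hn₂, hs₂, hp₂⟩ := ih (fun K hK => hP K (Finset.mem_insert_of_mem hK))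
      (fun K hK => hΔ K (Finset.mem_insert_of_mem hK))
    refine ⟨Δ₁ ∪ Δ₂, ?_, ?_, ?_, ?_⟩
    · intro K hK
      rcases Finset.mem_union.mp hK with h | h
      exacts [hc₁ K h, hc₂ K h]
    · rw [Finset.card_insert_of_notMem hR]
      have := Finset.card_union_le Δ₁ Δ₂
      omega
    · rw [Finset.set_biUnion_insert, Finset.set_biUnion_union]
      exact Set.union_subset_union hs₁ hs₂
    · simp only [Finset.sum_insert hR]
      exact hp₁.add hp₂

end

/-! ### Approximation over partitions into rings -/

lemma IsDyadicCube.measurableSet {K : Set (Fin d → ℝ)} (h : IsDyadicCube K) : MeasurableSet K := by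
  obtain ⟨-, j, α, rfl⟩ := h
  exact measurableSet_box _ _

lemma IsDyadicRing.measurableSet {R : Set (Fin d → ℝ)} (h : IsDyadicRing R) : MeasurableSet R := by
  rcases h with h | ⟨Q, Q', hQ, hQ', -, rfl⟩
  exacts [h.measurableSet, hQ.measurableSet.diff hQ'.measurableSet]

lemma sum_indicator_eq_of_mem {Δ : Finset (Set (Fin d → ℝ))}
    (hΔ : (Δ : Set (Set (Fin d → ℝ))).PairwiseDisjoint id)
    (P : Set (Fin d → ℝ) → MvPolynomial (Fin d) ℝ) {R : Set (Fin d → ℝ)} (hR : R ∈ Δ)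
    {x : Fin d → ℝ} (hx : x ∈ R) :
    ∑ K ∈ Δ, K.indicator (fun y => MvPolynomial.eval y (P K)) x = MvPolynomial.eval x (P R) := by
  rw [Finset.sum_eq_single_of_mem R hR, Set.indicator_of_mem hx]
  intro K hK hKR
  refine Set.indicator_of_notMem (fun hxK => ?_) _
  exact Set.disjoint_left.mp (hΔ hK hR hKR) hxK hx

/-- The threshold is chosen so that N t = 2(2^d + 1) W; the count in `decomposes_dyadic` then gives
c t ≤ N t. -/
lemma exists_decomposition {ψ : Set (Fin d → ℝ) → ℝ≥0∞} (hψ : Superadditive ψ) {W : ℝ≥0∞}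
    (hW0 : W ≠ 0) (hWt : W ≠ ∞) (hψW : ψ (unitCube d) ≤ W) {N : ℕ} (hN : 1 ≤ N) {t : ℝ≥0∞}
    (ht : t = ((2 * (2 ^ d + 1) : ℕ) : ℝ≥0∞) * W / N) (J : ℕ) :
    Decomposes (fun R => IsDyadicRing R ∧ (ψ R ≤ t ∨ ∃ β, R = dyadic J β)) (unitCube d) N := by
  have hN0 : (N : ℝ≥0∞) ≠ 0 := by exact_mod_cast (by omega : N ≠ 0)
  have hNt : (N : ℝ≥0∞) ≠ ∞ := ENNReal.natCast_ne_top N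
  have ht0 : t ≠ 0 := by
    rw [ht]
    refine ENNReal.div_ne_zero.mpr ⟨mul_ne_zero ?_ hW0, hNt⟩
    exact_mod_cast (by positivity : 2 * (2 ^ d + 1) ≠ 0)
  have htt : t ≠ ∞ := by
    rw [ht]
    exact ENNReal.div_ne_top (ENNReal.mul_ne_top (ENNReal.natCast_ne_top _) hWt) hN0
  obtain ⟨c, ⟨Δ, hc, hΔ⟩, hcN⟩ : ∃ c : ℕ, Decomposes
      (fun R => IsDyadicRing R ∧ (ψ R ≤ t ∨ ∃ β, R = dyadic J β)) (unitCube d) c ∧ c ≤ N := by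
    by_cases hle : ψ (unitCube d) ≤ t
    · exact ⟨1, Decomposes.single ⟨Or.inl isDyadicCube_unitCube, Or.inl hle⟩, hN⟩
    obtain ⟨c, hc, hct⟩ := decomposes_dyadic hψ t J J 0 0 (by omega) unitCube_eq_dyadic.ge
      (by rw [← unitCube_eq_dyadic]; exact not_le.mp hle) (unitCube d) isDyadicCube_unitCube
      unitCube_eq_dyadic.ge (by
        rw [← unitCube_eq_dyadic, Set.sdiff_self]
        -- Superadditivity and finite charge of the unit cube force ψ(∅) = 0.
        by_contra! hlt
        have h1 := hψ ∅ (unitCube d) (unitCube d) (Set.empty_disjoint _) (Set.empty_subset _)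
          subset_rfl
        have h2 : ψ (unitCube d) < ψ ∅ + ψ (unitCube d) := by
          rw [add_comm]
          exact ENNReal.lt_add_right (ne_top_of_le_ne_top hWt hψW) (bot_le.trans_lt hlt).ne'
        exact absurd h1 (not_le.mpr h2))
    refine ⟨c, hc, ?_⟩
    have h1 : (c : ℝ≥0∞) * t ≤ N * t := by
      calc (c : ℝ≥0∞) * t ≤ ((c + (2 ^ d + 1) : ℕ) : ℝ≥0∞) * t := by gcongr; exact Nat.le_add_right _ _
        _ ≤ ((2 * (2 ^ d + 1) : ℕ) : ℝ≥0∞) * W := hct.trans (by gcongr)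
        _ = N * t := by rw [ht, ENNReal.mul_div_cancel hN0 hNt]
    exact_mod_cast (ENNReal.mul_le_mul_iff_left ht0 htt).mp h1
  exact ⟨Δ, hc.trans hcN, hΔ⟩

lemma exists_ring_approximation (d k : ℕ) (hd : 2 ≤ d) : ∃ C : ℝ≥0∞, C ≠ ∞ ∧
    ∀ (p : ℝ) (q : ℝ≥0∞), 1 ≤ p → 1 ≤ q → ∀ f : (Fin d → ℝ) → ℝ, MemV k p q f →
      (q = ∞ → UniformContinuousOn f (unitCube d)) → ∀ N : ℕ, 1 ≤ N →
      ∃ (Δ : Finset (Set (Fin d → ℝ))) (P : Set (Fin d → ℝ) → MvPolynomial (Fin d) ℝ),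
        IsRingPartition Δ ∧ Δ.card ≤ N ∧ (∀ R ∈ Δ, (P R).totalDegree ≤ k - 1) ∧
        eLpNorm (fun x => f x - ∑ R ∈ Δ, R.indicator (fun y => MvPolynomial.eval y (P R)) x) q
          (volume.restrict (unitCube d)) ≤
            C * ((N : ℝ≥0∞) ^ (-(1 / p - (q⁻¹).toReal)) * seminormV k p q f) := by
  classical
  obtain ⟨C, hCt, hC⟩ := exists_approxOn_ring d k hd
  set A : ℕ := 2 * (2 ^ d + 1) with hA
  refine ⟨2 * (C * A + 1), by finiteness, ?_⟩
  intro p q hp hq f ⟨hf, hV⟩ hfu N hN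
  have hp0 : 0 < p := by linarith
  set V := seminormV k p q f with hVdef
  set ψ := cubeCharge k p q f
  have hψ : Superadditive ψ := superadditive_cubeCharge
  have hψV : ψ (unitCube d) ≤ V ^ p := cubeCharge_unitCube_le hp0
  have hN0 : (N : ℝ≥0∞) ≠ 0 := by exact_mod_cast (by omega : N ≠ 0)
  have hNt : (N : ℝ≥0∞) ≠ ∞ := ENNReal.natCast_ne_top N
  -- For V = 0 the tolerance `η` would vanish and no level J need exist. In this case one polynomial
  -- agrees with f almost everywhere on the unit cube.
  rcases eq_or_ne V 0 with hV0 | hV0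
  · obtain ⟨m, hm, hme⟩ := hC f q hq hf (unitCube d) (Or.inl isDyadicCube_unitCube) 0 (by
      intro K hK hKu
      refine (bestApprox_le_of_subset hp0 hK hKu).trans ?_
      rw [ENNReal.rpow_inv_le_iff hp0, ← hV0]
      exact hψV)
    refine ⟨{unitCube d}, fun _ => m, ⟨?_, by simp, by simp⟩, by simpa using hN, by simpa using hm, ?_⟩
    · intro R hR
      rw [Finset.mem_singleton.mp hR]
      exact Or.inl isDyadicCube_unitCube
    refine le_trans (le_of_eq ?_) (hme.trans (by simp))
    refine eLpNorm_congr_ae ((ae_restrict_mem isDyadicCube_unitCube.measurableSet).mono ?_)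
    intro x hx
    simp [hx]
  set τ : ℝ := 1 / p - (q⁻¹).toReal
  set η : ℝ≥0∞ := (N : ℝ≥0∞) ^ (-τ) * V with hη
  have hη0 : η ≠ 0 := mul_ne_zero (by simp [ENNReal.rpow_eq_zero_iff, hN0, hNt]) hV0
  obtain ⟨J, v, hv⟩ := exists_eLpNorm_sub_dyadicIndex_le hq hf hfu hη0
  set t : ℝ≥0∞ := (A : ℝ≥0∞) * V ^ p / N with ht
  have hVp0 : V ^ p ≠ 0 := by simp [ENNReal.rpow_eq_zero_iff, hV0, hV.ne]
  obtain ⟨Δ, hcard, hG, hdis, hunion⟩ := exists_decomposition hψ hVp0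
    (ENNReal.rpow_ne_top_of_nonneg hp0.le hV.ne) hψV hN ht J
  have hex : ∀ R : Set (Fin d → ℝ), ∃ m : MvPolynomial (Fin d) ℝ, R ∈ Δ → m.totalDegree ≤ k - 1 ∧
      (ψ R ≤ t → ApproxOn f q m R (C * t ^ p⁻¹)) ∧
      (¬ ψ R ≤ t → ∀ x ∈ R, MvPolynomial.eval x m = v (dyadicIndex J x)) := by
    intro R
    by_cases hR : R ∈ Δ
    · by_cases hRt : ψ R ≤ t
      · obtain ⟨m, hm, hme⟩ := hC f q hq hf R (hG R hR).1 (t ^ p⁻¹) fun K hK hKR =>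
          (bestApprox_le_of_subset hp0 hK hKR).trans (ENNReal.rpow_le_rpow hRt (by positivity))
        exact ⟨m, fun _ => ⟨hm, fun _ => hme, fun h => absurd hRt h⟩⟩
      · obtain ⟨β, rfl⟩ := (hG R hR).2.resolve_left hRt
        refine ⟨MvPolynomial.C (v β), fun _ => ⟨by simp, fun h => absurd h hRt, fun _ x hx => ?_⟩⟩
        have : dyadicIndex J x = β := funext (mem_dyadic.mp hx)
        simp [this]
    · exact ⟨0, fun h => absurd h hR⟩
  choose P hP using hex
  refine ⟨Δ, P, ⟨fun R hR => (hG R hR).1, hdis, hunion⟩, hcard, fun R hR => (hP R hR).1, ?_⟩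
  set F : (Fin d → ℝ) → ℝ :=
    fun x => f x - ∑ R ∈ Δ, R.indicator (fun y => MvPolynomial.eval y (P R)) x with hF
  have hFR : ∀ R ∈ Δ, ∀ x ∈ R, F x = f x - MvPolynomial.eval x (P R) := fun R hR x hx => by
    simp only [hF]
    rw [sum_indicator_eq_of_mem hdis P hR hx]
  let U : Bool → Set (Fin d → ℝ) := fun b =>
    if b then ⋃ R ∈ Δ.filter (fun R => ψ R ≤ t), R else ⋃ R ∈ Δ.filter (fun R => ¬ ψ R ≤ t), R
  have hsmall : eLpNorm F q (volume.restrict (U true)) ≤ C * A * η := by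
    have h1 : ∀ R ∈ Δ.filter (fun R => ψ R ≤ t),
        eLpNorm F q (volume.restrict R) ≤ C * t ^ p⁻¹ := by
      intro R hR
      rw [Finset.mem_filter] at hR
      refine le_trans (le_of_eq ?_) ((hP R hR.1).2.1 hR.2)
      exact eLpNorm_congr_ae ((ae_restrict_mem (hG R hR.1).1.measurableSet).mono (hFR R hR.1))
    have h2 : t ^ p⁻¹ ≤ A * V * (N : ℝ≥0∞) ^ (-(1 / p)) := by
      rw [ht, ENNReal.div_rpow_of_nonneg _ _ (by positivity),
        ENNReal.mul_rpow_of_nonneg _ _ (by positivity), ENNReal.rpow_rpow_inv hp0.ne',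
        div_eq_mul_inv, one_div, ENNReal.rpow_neg]
      gcongr
      -- Since A ≥ 1 and p ≥ 1, A^{1/p} ≤ A, which frees the constant from p.
      have h3 : (1 : ℝ≥0∞) ≤ A := by
        exact_mod_cast (by positivity : 0 < A)
      calc (A : ℝ≥0∞) ^ p⁻¹ ≤ (A : ℝ≥0∞) ^ (1 : ℝ) :=
            ENNReal.rpow_le_rpow_of_exponent_le h3 (inv_le_one_of_one_le₀ hp)
        _ = A := ENNReal.rpow_one _
    have h4 : (N : ℝ≥0∞) ^ (-τ) = (N : ℝ≥0∞) ^ (q⁻¹).toReal * (N : ℝ≥0∞) ^ (-(1 / p)) := by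
      rw [← ENNReal.rpow_add _ _ hN0 hNt]
      congr 1
      simp only [τ]
      ring
    have h5 : ((Δ.filter (fun R => ψ R ≤ t)).card : ℝ≥0∞) ≤ N := by
      exact_mod_cast (Finset.card_filter_le _ _).trans hcard
    calc _ ≤ _ := eLpNorm_biUnion_le (zero_lt_one.trans_le hq).ne' _ (fun R => R) h1
      _ ≤ (N : ℝ≥0∞) ^ (q⁻¹).toReal * (C * (A * V * (N : ℝ≥0∞) ^ (-(1 / p)))) := by gcongr
      _ = C * A * η := by rw [hη, h4]; ring
  have hfine : eLpNorm F q (volume.restrict (U false)) ≤ η := by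
    have hUm : MeasurableSet (U false) :=
      Finset.measurableSet_biUnion _ fun R hR => (hG R (Finset.mem_filter.mp hR).1).1.measurableSet
    have hUs : U false ⊆ unitCube d := by
      rw [← hunion]
      exact Set.iUnion₂_subset fun R hR =>
        Set.subset_biUnion_of_mem (u := id) (Finset.mem_filter.mp hR).1
    refine le_trans (le_of_eq ?_) ((eLpNorm_mono_measure _
      (Measure.restrict_mono hUs le_rfl)).trans hv)
    refine eLpNorm_congr_ae ((ae_restrict_mem hUm).mono fun x hx => ?_)
    obtain ⟨R, hR, hxR⟩ := Set.mem_iUnion₂.mp hx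
    rw [Finset.mem_filter] at hR
    rw [hFR R hR.1 x hxR, (hP R hR.1).2.2 hR.2 x hxR]
  have hcov : unitCube d ⊆ ⋃ b ∈ (Finset.univ : Finset Bool), U b := by
    rw [← hunion]
    refine Set.iUnion₂_subset fun R hR x hx => ?_
    simp only [Finset.mem_univ, Set.iUnion_true, Set.mem_iUnion]
    by_cases h : ψ R ≤ t
    · exact ⟨true, Set.mem_iUnion₂.mpr ⟨R, Finset.mem_filter.mpr ⟨hR, h⟩, hx⟩⟩
    · exact ⟨false, Set.mem_iUnion₂.mpr ⟨R, Finset.mem_filter.mpr ⟨hR, h⟩, hx⟩⟩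
  refine (eLpNorm_mono_measure _ (Measure.restrict_mono hcov le_rfl)).trans ?_
  refine (eLpNorm_biUnion_le_card_mul hq Finset.univ U (e := (C * A + 1) * η) ?_).trans
    (by simp [mul_assoc])
  rintro (_ | _) -
  · exact hfine.trans (le_mul_of_one_le_left' le_add_self)
  · exact hsmall.trans (by gcongr; exact le_self_add)

/-- Passing from partitions into rings to coverings by cubes. -/
lemma exists_cube_approximation (d k : ℕ) (hd : 2 ≤ d) : ∃ C : ℝ≥0∞, C ≠ ∞ ∧
    ∀ (p : ℝ) (q : ℝ≥0∞), 1 ≤ p → 1 ≤ q → 0 ≤ 1 / p - (q⁻¹).toReal →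
      ∀ f : (Fin d → ℝ) → ℝ, MemV k p q f →
      (q = ∞ → UniformContinuousOn f (unitCube d)) → ∀ N : ℕ, 1 ≤ N →
      ∃ (Δ : Finset (Set (Fin d → ℝ))) (g : (Fin d → ℝ) → ℝ),
        IsDyadicCovering Δ ∧ Δ.card ≤ N ∧ IsPiecewisePoly (k - 1) Δ g ∧
        eLpNorm (fun x => f x - g x) q (volume.restrict (unitCube d)) ≤
            C * ((N : ℝ≥0∞) ^ (-(1 / p - (q⁻¹).toReal)) * seminormV k p q f) := by
  obtain ⟨C, hCt, hC⟩ := exists_ring_approximation d k hd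
  obtain ⟨C', hCt', hC'⟩ := exists_approxOn_ring d k hd
  refine ⟨max (C * 3) C', by simp [ENNReal.mul_ne_top hCt, hCt'], ?_⟩
  intro p q hp hq hτ f hf hfu N hN
  have hp0 : 0 < p := by linarith
  -- For N = 1 there is no room for a ring, as ⌊N/2⌋ = 0; the unit cube itself is used.
  rcases hN.eq_or_lt with rfl | hN2
  · obtain ⟨m, hm, hme⟩ := hC' f q hq hf.1 (unitCube d) (Or.inl isDyadicCube_unitCube)
      (seminormV k p q f) (by
        intro K hK hKu
        refine (bestApprox_le_of_subset hp0 hK hKu).trans ?_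
        rw [ENNReal.rpow_inv_le_iff hp0]
        exact cubeCharge_unitCube_le hp0)
    refine ⟨{unitCube d}, _, ⟨by simpa using isDyadicCube_unitCube, by simp⟩, by simp,
      isPiecewisePoly_singleton hm _, ?_⟩
    refine le_trans (le_of_eq ?_) (hme.trans ?_)
    · refine eLpNorm_congr_ae ((ae_restrict_mem isDyadicCube_unitCube.measurableSet).mono ?_)
      intro x hx
      simp [hx]
    · simp only [Nat.cast_one, ENNReal.one_rpow, one_mul]
      gcongr
      exact le_max_right _ _
  · set n := N / 2
    have hn : 1 ≤ n := by omega
    obtain ⟨Δ, P, ⟨hΔ, -, hunion⟩, hcard, hP, hle⟩ := hC p q hp hq f hf hfu n hn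
    obtain ⟨Δ', hc', hn', hs', hp'⟩ := exists_cubes_of_rings P Δ hP hΔ
    refine ⟨Δ', _, ⟨hc', ?_⟩, by omega, hp', hle.trans ?_⟩
    · refine (Set.iUnion₂_subset fun K hK => (hc' K hK).1).antisymm ?_
      rwa [hunion] at hs'
    · set τ := 1 / p - (q⁻¹).toReal
      -- With τ ≤ 1 and N ≤ 3⌊N/2⌋, halving the number of pieces costs at most a factor 3, uniformly
      -- in p and q.
      have hτ1 : τ ≤ 1 := by
        have h1 : 1 / p ≤ 1 := by rw [div_le_one hp0]; exact hp
        have h2 : 0 ≤ (q⁻¹).toReal := ENNReal.toReal_nonneg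
        simp only [τ]
        linarith
      have hn0 : (n : ℝ≥0∞) ≠ 0 := by exact_mod_cast (by omega : n ≠ 0)
      have h3 : (n : ℝ≥0∞) ^ (-τ) ≤ 3 * (N : ℝ≥0∞) ^ (-τ) := by
        have h4 : (N : ℝ≥0∞) ≤ 3 * n := by exact_mod_cast (by omega : N ≤ 3 * n)
        have h5 : (N : ℝ≥0∞) ^ τ ≤ 3 * (n : ℝ≥0∞) ^ τ := by
          calc (N : ℝ≥0∞) ^ τ ≤ (3 * n) ^ τ := ENNReal.rpow_le_rpow h4 hτ
            _ = 3 ^ τ * (n : ℝ≥0∞) ^ τ := ENNReal.mul_rpow_of_nonneg _ _ hτ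
            _ ≤ 3 ^ (1 : ℝ) * (n : ℝ≥0∞) ^ τ := by
              gcongr
              norm_num
            _ = _ := by rw [ENNReal.rpow_one]
        have hnτ0 : (n : ℝ≥0∞) ^ τ ≠ 0 := by
          simp [ENNReal.rpow_eq_zero_iff, hn0]
        have hNτ0 : (N : ℝ≥0∞) ^ τ ≠ 0 := by
          have : (N : ℝ≥0∞) ≠ 0 := by exact_mod_cast (by omega : N ≠ 0)
          simp [ENNReal.rpow_eq_zero_iff, this]
        have hnτt : (n : ℝ≥0∞) ^ τ ≠ ∞ :=
          ENNReal.rpow_ne_top_of_nonneg hτ (ENNReal.natCast_ne_top n)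
        have hNτt : (N : ℝ≥0∞) ^ τ ≠ ∞ :=
          ENNReal.rpow_ne_top_of_nonneg hτ (ENNReal.natCast_ne_top N)
        rw [ENNReal.rpow_neg, ENNReal.rpow_neg, ← div_eq_mul_inv,
          ENNReal.le_div_iff_mul_le (Or.inl hNτ0) (Or.inl hNτt), mul_comm, ← div_eq_mul_inv]
        exact ENNReal.div_le_of_le_mul h5
      calc C * ((n : ℝ≥0∞) ^ (-τ) * seminormV k p q f)
          ≤ C * (3 * (N : ℝ≥0∞) ^ (-τ) * seminormV k p q f) := by gcongr
        _ = C * 3 * ((N : ℝ≥0∞) ^ (-τ) * seminormV k p q f) := by ring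
        _ ≤ _ := by
          gcongr
          exact le_max_left _ _

end PiecewiseApprox

end

open PiecewiseApprox in
theorem theorem2p1 (d : ℕ) (hd : 2 ≤ d) (k : ℕ) :
    ∃ c : ℝ, 0 < c ∧
      ∀ (p : ℝ) (q : ℝ≥0∞), 1 ≤ p → ENNReal.ofReal p < q →
        0 < smoothness d p q → smoothness d p q ≤ k →
        ∀ f : (Fin d → ℝ) → ℝ, MemV k p q f →
          (q = ∞ → UniformContinuousOn f (unitCube d)) →
          ∀ N : ℕ, 1 ≤ N →
            (∃ (Δ : Finset (Set (Fin d → ℝ))) (g : (Fin d → ℝ) → ℝ),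
              IsDyadicCovering Δ ∧ Δ.card ≤ N ∧ IsPiecewisePoly (k - 1) Δ g ∧
              eLpNorm (fun x => f x - g x) q (volume.restrict (unitCube d)) ≤
                ENNReal.ofReal (c * (N : ℝ) ^ (-(smoothness d p q / d))) * seminormV k p q f) ∧
            (∃ (Δ : Finset (Set (Fin d → ℝ))) (g : (Fin d → ℝ) → ℝ),
              IsRingPartition Δ ∧ Δ.card ≤ N ∧ IsPiecewisePoly (k - 1) Δ g ∧
              eLpNorm (fun x => f x - g x) q (volume.restrict (unitCube d)) ≤
                ENNReal.ofReal (c * (N : ℝ) ^ (-(smoothness d p q / d))) * seminormV k p q f) := by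
  obtain ⟨C₁, hC₁t, hC₁⟩ := exists_cube_approximation d k hd
  obtain ⟨C₂, hC₂t, hC₂⟩ := exists_ring_approximation d k hd
  have hmax : max C₁ C₂ ≠ ∞ := by simp [hC₁t, hC₂t]
  -- The summand 1 only makes the constant positive.
  refine ⟨(max C₁ C₂).toReal + 1, by positivity, ?_⟩
  intro p q hp hpq hs _ f hf hfu N hN
  have hd0 : (0 : ℝ) < d := by exact_mod_cast (by omega : 0 < d)
  have hq : 1 ≤ q := by
    refine le_trans ?_ hpq.le
    simpa using ENNReal.ofReal_le_ofReal hp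
  have hτ : smoothness d p q / d = 1 / p - (q⁻¹).toReal := by
    rw [smoothness, mul_div_cancel_left₀ _ hd0.ne']
  have hτ0 : 0 ≤ 1 / p - (q⁻¹).toReal := by
    rw [← hτ]
    positivity
  have hNpos : (0 : ℝ) < N := by exact_mod_cast hN
  have hbound : ∀ C ≤ max C₁ C₂,
      C * ((N : ℝ≥0∞) ^ (-(1 / p - (q⁻¹).toReal)) * seminormV k p q f) ≤
        ENNReal.ofReal (((max C₁ C₂).toReal + 1) * (N : ℝ) ^ (-(smoothness d p q / d))) *
          seminormV k p q f := by
    intro C hC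
    rw [hτ, ENNReal.ofReal_mul (by positivity), ← ENNReal.ofReal_rpow_of_pos hNpos,
      ENNReal.ofReal_natCast, ← mul_assoc]
    gcongr
    refine hC.trans ?_
    rw [ENNReal.ofReal_add ENNReal.toReal_nonneg zero_le_one, ENNReal.ofReal_toReal hmax]
    exact le_self_add
  constructor
  · obtain ⟨Δ, g, hΔ, hcard, hg, hle⟩ := hC₁ p q hp hq hτ0 f hf hfu N hN
    exact ⟨Δ, g, hΔ, hcard, hg, hle.trans (hbound _ (le_max_left _ _))⟩
  · obtain ⟨Δ, P, hΔ, hcard, hP, hle⟩ := hC₂ p q hp hq f hf hfu N hN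
    exact ⟨Δ, _, hΔ, hcard, ⟨P, hP, fun x => rfl⟩, hle.trans (hbound _ (le_max_right _ _))⟩
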